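/- Notation. For integers $d,N\ge 1$ a tensor is $T\in\mathbb R^{N^d}$ with entries $T_\omega$, $\omega=(i_1,\dots,i_d)\in[N]^d$; $\|T\|_\infty=\max_\omega|T_\omega|$. For matrices $U^{(j)}\in\mathbb R^{N\times r}$ write $(U^{(1)}\circ\cdots\circ U^{(d)})_\omega=\sum_{k=1}^r\prod_{j=1}^d U^{(j)}(i_j,k)$, and let $\|U\|_{2,\infty}$ be the largest Euclidean norm of a row of $U$. The max-qnorm and the M-norm of $T$ are $$\|T\|_{\max}=\inf\Big\{\prod_{j=1}^d\|U^{(j)}\|_{2,\infty}:\ r\ge 0,\ T=U^{(1)}\circ\cdots\circ U^{(d)}\Big\},\qquad \|T\|_M=\inf\{t>0:\ T\in t\,\mathrm{conv}(T_\pm)\},$$ where $T_\pm$ is the set of tensors of (CP) rank one with all entries in $\{\pm1\}$. Put $K_{\max}(\alpha,R)=\{X:\|X\|_\infty\le\alpha,\ \|X\|_{\max}\le R\}$ and $K_M(\alpha,R)=\{X:\|X\|_\infty\le\alpha,\ \|X\|_M\le R\}$. Let $f:\mathbb R\to[0,1]$ be nondecreasing and differentiable, such that $f$, $1-f$ and $f'$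 do not vanish on $[-\alpha,\alpha]$ and the following suprema are finite: $$L_\alpha=\sup_{|x|\le\alpha}\frac{|f'(x)|}{f(x)(1-f(x))},\qquad \beta_\alpha=\sup_{|x|\le\alpha}\frac{f(x)(1-f(x))}{f'(x)^2},\qquad U_\alpha=\sup_{|x|\le\alpha}\log\frac1{f(x)(1-f(x))}.$$ Let $\Pi=(\pi_\omega)$ be a probability distribution on $[N]^d$ and let $T^\sharp\in\mathbb R^{N^d}$ with $\|T^\sharp\|_\infty\le\alpha$. We observe $m$ independent pairs $(\omega_t,Y_t)$, $t=1,\dots,m$, where $\omega_t\sim\Pi$ and, given $\omega_t$, $Y_t=+1$ with probability $f(T^\sharp_{\omega_t})$ and $Y_t=-1$ with probability $1-f(T^\sharp_{\omega_t})$. Let $$\mathcal L(X)=\sum_{t=1}^m\Big(\mathbf 1_{[Y_t=1]}\log\frac1{f(X_{\omega_t})}+\mathbf 1_{[Y_t=-1]}\log\frac1{1-f(X_{\omega_t})}\Big),\qquad \|X\|_\Pi^2=\sum_\omega\pi_\omega X_\omega^2 .$$ Theorem. There are absolute constants $C_{\max},C_M>0$ and $0<c_2<\sqrt2$ such that, for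 all $d,N,m$ with $2\le m\le N^d$ and all $\alpha,f,\Pi,T^\sharp$ as above, the following hold. (i) If $d\ge2$ and $\|T^\sharp\|_{\max}\le R_{\max}$, then $\mathcal L$ has a minimizer over $K_{\max}(\alpha,R_{\max})$, and for every $\delta>0$, with probability at least $1-\delta$, every such minimizer $\hat T_{\max}$ satisfies $$\|T^\sharp-\hat T_{\max}\|_\Pi^2\le C_{\max}\,c_2^d\,\beta_\alpha\Big(L_\alpha R_{\max}\sqrt{\tfrac{dN}{m}}+U_\alpha\sqrt{\tfrac{\log(4/\delta)}{m}}\Big).$$ (ii) If $\|T^\sharp\|_M\le R_M$, then $\mathcal L$ has a minimizer over $K_M(\alpha,R_M)$, and for every $\delta>0$, with probability at least $1-\delta$, every such minimizer $\hat T_M$ satisfies $$\|T^\sharp-\hat T_M\|_\Pi^2\le C_M\,\beta_\alpha\Big(L_\alpha R_M\sqrt{\tfrac{dN}{m}}+U_\alpha\sqrt{\tfrac{\log(4/\delta)}{m}}\Big).$$ (For $\delta\ge 1$ both probability claims are void, so $\sqrt{\log(4/\delta)}$ is only relevant for $\delta<1$.) -/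

import Mathlib

open scoped BigOperators Pointwise
open MeasureTheory ProbabilityTheory

namespace OneBit

/-- Real tensors of order `d` and size `N × ⋯ × N`, indexed by `ω = (i₁, …, i_d)`. -/
abbrev Tensor (d N : ℕ) : Type := (Fin d → Fin N) → ℝ

/-- The outer product `u₁ ∘ ⋯ ∘ u_d` of vectors. -/
def outerVec {d N : ℕ} (u : Fin d → Fin N → ℝ) : Tensor d N :=
  fun ω => ∏ j, u j (ω j)

/-- The outer product `U₁ ∘ ⋯ ∘ U_d` of matrices with a common number of columns. -/
def outerMat {d N r : ℕ} (U : Fin d → Matrix (Fin N) (Fin r) ℝ) : Tensor d N :=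
  fun ω => ∑ k, ∏ j, U j (ω j) k

/-- A unit tensor is an outer product of vectors of Euclidean norm one. -/
def IsUnitTensor {d N : ℕ} (T : Tensor d N) : Prop :=
  ∃ u : Fin d → Fin N → ℝ, (∀ j, ∑ i, u j i ^ 2 = 1) ∧ T = outerVec u

/-- A rank-one tensor is a nonzero scalar multiple of a unit tensor. -/
def IsRankOneTensor {d N : ℕ} (T : Tensor d N) : Prop :=
  ∃ (c : ℝ) (U : Tensor d N), c ≠ 0 ∧ IsUnitTensor U ∧ T = c • U

/-- The (CP) rank: the smallest number of rank-one tensors that sum to `T`. -/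
noncomputable def tensorRank {d N : ℕ} (T : Tensor d N) : ℕ :=
  sInf {r : ℕ | ∃ S : Fin r → Tensor d N, (∀ i, IsRankOneTensor (S i)) ∧ T = ∑ i, S i}

/-- The set of sign tensors (all entries `±1`) of rank one. -/
def signTensors (d N : ℕ) : Set (Tensor d N) :=
  {T | (∀ ω, T ω = 1 ∨ T ω = -1) ∧ tensorRank T = 1}

/-- The atomic M-norm, i.e. the gauge of the convex hull of the rank-one sign tensors. -/
noncomputable def mNorm {d N : ℕ} (T : Tensor d N) : ℝ :=
  sInf {t : ℝ | 0 < t ∧ T ∈ t • convexHull ℝ (signTensors d N)}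

/-- `‖U‖_{2,∞}`, the largest Euclidean norm of a row of `U`. -/
noncomputable def twoInftyNorm {N r : ℕ} (U : Matrix (Fin N) (Fin r) ℝ) : ℝ :=
  ⨆ i, Real.sqrt (∑ k, U i k ^ 2)

/-- The max-qnorm; the number `r` of columns of the factors is arbitrary. -/
noncomputable def maxQNorm {d N : ℕ} (T : Tensor d N) : ℝ :=
  sInf {c : ℝ | ∃ (r : ℕ) (U : Fin d → Matrix (Fin N) (Fin r) ℝ),
    T = outerMat U ∧ c = ∏ j, twoInftyNorm (U j)}

/-- `K_max(α, R)`: tensors with `‖T‖_∞ ≤ α` and max-qnorm at most `R`. -/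
def KMax (d N : ℕ) (α R : ℝ) : Set (Tensor d N) :=
  {T | (∀ ω, |T ω| ≤ α) ∧ maxQNorm T ≤ R}

/-- `K_M(α, R)`: tensors with `‖T‖_∞ ≤ α` and M-norm at most `R`. -/
def KM (d N : ℕ) (α R : ℝ) : Set (Tensor d N) :=
  {T | (∀ ω, |T ω| ≤ α) ∧ mNorm T ≤ R}

/-- The steepness functional `x ↦ |f'(x)| / (f(x)(1 - f(x)))`. -/
noncomputable def steepness (f : ℝ → ℝ) (x : ℝ) : ℝ := |deriv f x| / (f x * (1 - f x))

/-- The flatness functional `x ↦ f(x)(1 - f(x)) / f'(x)²`. -/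
noncomputable def flatness (f : ℝ → ℝ) (x : ℝ) : ℝ := f x * (1 - f x) / (deriv f x) ^ 2

/-- The functional `x ↦ log (1 / (f(x)(1 - f(x))))`. -/
noncomputable def logVar (f : ℝ → ℝ) (x : ℝ) : ℝ := Real.log (1 / (f x * (1 - f x)))

/-- `L_α`. -/
noncomputable def Lconst (f : ℝ → ℝ) (α : ℝ) : ℝ := sSup (steepness f '' Set.Icc (-α) α)

/-- `β_α`. -/
noncomputable def betaConst (f : ℝ → ℝ) (α : ℝ) : ℝ := sSup (flatness f '' Set.Icc (-α) α)

/-- `U_α`. -/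
noncomputable def Uconst (f : ℝ → ℝ) (α : ℝ) : ℝ := sSup (logVar f '' Set.Icc (-α) α)

/-- Admissible link functions: `f : ℝ → [0,1]` is monotone and differentiable, on `[-α, α]` none of
`f`, `1 - f`, `f'` vanishes, and the suprema defining `L_α`, `β_α`, `U_α` are finite. -/
structure IsLink (f : ℝ → ℝ) (α : ℝ) : Prop where
  mem_Icc : ∀ x, f x ∈ Set.Icc (0 : ℝ) 1
  mono : Monotone f
  diff : Differentiable ℝ f
  ne_zero : ∀ x ∈ Set.Icc (-α) α, f x ≠ 0
  ne_one : ∀ x ∈ Set.Icc (-α) α, f x ≠ 1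
  deriv_ne_zero : ∀ x ∈ Set.Icc (-α) α, deriv f x ≠ 0
  bddL : BddAbove (steepness f '' Set.Icc (-α) α)
  bddBeta : BddAbove (flatness f '' Set.Icc (-α) α)
  bddU : BddAbove (logVar f '' Set.Icc (-α) α)

/-- The observation model. The pairs `(ω_t, Y_t)`, `t = 1, …, m`, are independent, the index `ω_t`
has distribution `p`, and given `ω_t = ω` the bit `Y_t` is `+1` with probability `f(T_ω)` and `-1`
with probability `1 - f(T_ω)`. -/
structure IsOneBitSample {d N m : ℕ} {S : Type*} [MeasurableSpace S] (P : Measure S)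
    (p : (Fin d → Fin N) → ℝ) (f : ℝ → ℝ) (T : Tensor d N)
    (idx : Fin m → S → (Fin d → Fin N)) (Y : Fin m → S → ℤ) : Prop where
  measurable_idx : ∀ t, Measurable (idx t)
  measurable_Y : ∀ t, Measurable (Y t)
  indep : iIndepFun (fun t s => (idx t s, Y t s)) P
  law_pos : ∀ t ω, P.real {s | idx t s = ω ∧ Y t s = 1} = p ω * f (T ω)
  law_neg : ∀ t ω, P.real {s | idx t s = ω ∧ Y t s = -1} = p ω * (1 - f (T ω))

/-- The negative log-likelihood of `X` for sampled indices `idx` (repetitions are counted with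
multiplicity) and observed bits `Y`. -/
noncomputable def negLogLik {d N m : ℕ} (f : ℝ → ℝ) (idx : Fin m → (Fin d → Fin N))
    (Y : Fin m → ℤ) (X : Tensor d N) : ℝ :=
  ∑ t, ((if Y t = 1 then Real.log (1 / f (X (idx t))) else 0)
    + (if Y t = -1 then Real.log (1 / (1 - f (X (idx t)))) else 0))

/-- The set of maximum likelihood estimators over the constraint set `K`. -/
def estimators {d N m : ℕ} (f : ℝ → ℝ) (K : Set (Tensor d N)) (idx : Fin m → (Fin d → Fin N))
    (Y : Fin m → ℤ) : Set (Tensor d N) :=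
  {X | X ∈ K ∧ ∀ Z ∈ K, negLogLik f idx Y X ≤ negLogLik f idx Y Z}

/-- The squared weighted norm `‖X‖_Π² = ∑_ω π_ω X(ω)²`. -/
def sqNormPi {d N : ℕ} (p : (Fin d → Fin N) → ℝ) (X : Tensor d N) : ℝ :=
  ∑ ω, p ω * X ω ^ 2

end OneBit

/-! The population excess risk of the log-likelihood is a relative entropy, which dominates a
squared Hellinger distance and hence, through `betaConst`, the squared error
(`IsLink.sq_sub_le_relEntropy`). A minimizer has nonpositive empirical excess risk, so its error is
controlled by the supremum of a centred empirical process. Bounded differences (`sum_prod_tail_le`)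
replace this supremum by its mean, symmetrization with contraction (`prodExp_iSup_centred_le`)
replaces the losses by Rademacher sums of entries, and these are small as soon as linear functionals
on the constraint set are at most `D` times their maximum over a finite family of log-cardinality
`O(dN)` (`sum_prod_bad_le`).

For the M-norm the family is the set of rank-one sign tensors, with `D = R_M`. For the max-qnorm,
domination is a multilinear Grothendieck inequality (`norm_quatForm_le`): the last two orders are
handled by Grothendieck's inequality with vector coefficients (`norm_gramForm_le`), and each further
order costs one Khintchine constant. Real signs cannot give a constant below `√2`. Random quaternion
units `±1, ±i, ±j, ±k` give `√(3/2)` (`sqrt_sum_norm_sq_le`), and replacing the quaternion unit ball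
by a finite `1/10`-net costs `10/9` per order; the product is still below `√2`. The real coordinates
of rank-one quaternion tensors with entries in the net form a family of cardinality `exp(O(dN))`, as
required.

Minimizers exist because both constraint sets are compact; the delicate point is closedness of
max-qnorm balls, where the number of columns is unbounded. -/

namespace OneBit

/-! ### Product expectations on finite spaces and the bounded differences inequality. -/

section FiniteProbability

theorem sum_fin_succ_pi {Z M : Type*} [Fintype Z] [AddCommMonoid M] {m : ℕ}
    (F : (Fin (m + 1) → Z) → M) :
    ∑ z, F z = ∑ y, ∑ z' : Fin m → Z, F (Fin.cons y z') := by
  rw [← Fintype.sum_prod_type']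
  exact (Fintype.sum_equiv (Fin.consEquiv fun _ => Z) _ _ fun _ => rfl).symm

/-- Expectation of `F (z₁, …, z_m)` for independent `z_t` with weights `w`. -/
noncomputable def prodExp {Z : Type*} [Fintype Z] (w : Z → ℝ) {m : ℕ}
    (F : (Fin m → Z) → ℝ) : ℝ :=
  ∑ z, (∏ t, w (z t)) * F z

/-- Probability weights on a finite type. -/
structure IsWeight {Z : Type*} [Fintype Z] (w : Z → ℝ) : Prop where
  nonneg : ∀ z, 0 ≤ w z
  sum_eq : ∑ z, w z = 1

variable {Z : Type*} [Fintype Z] {w : Z → ℝ} {m : ℕ}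

theorem prodExp_zero (F : (Fin 0 → Z) → ℝ) : prodExp w F = F Fin.elim0 := by
  simp only [prodExp, Finset.univ_eq_empty, Finset.prod_empty, one_mul]
  rw [Fintype.sum_eq_single Fin.elim0]
  intro x hx
  exact absurd (Subsingleton.elim _ _) hx

theorem prodExp_succ (F : (Fin (m + 1) → Z) → ℝ) :
    prodExp w F = ∑ y, w y * prodExp w (fun z : Fin m → Z => F (Fin.cons y z)) := by
  simp only [prodExp, sum_fin_succ_pi, Fin.prod_univ_succ, Fin.cons_zero, Fin.cons_succ,
    Finset.mul_sum, mul_assoc]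

theorem prodExp_add (F G : (Fin m → Z) → ℝ) :
    prodExp w (fun z => F z + G z) = prodExp w F + prodExp w G := by
  simp only [prodExp, mul_add, Finset.sum_add_distrib]

theorem prodExp_const_mul (c : ℝ) (F : (Fin m → Z) → ℝ) :
    prodExp w (fun z => c * F z) = c * prodExp w F := by
  simp only [prodExp, Finset.mul_sum]
  exact Finset.sum_congr rfl fun z _ => by ring

theorem prodExp_sum {ι : Type*} (s : Finset ι) (F : ι → (Fin m → Z) → ℝ) :
    prodExp w (fun z => ∑ i ∈ s, F i z) = ∑ i ∈ s, prodExp w (F i) := by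
  simp only [prodExp, Finset.mul_sum]
  exact Finset.sum_comm

theorem IsWeight.prod_nonneg (hw : IsWeight w) (z : Fin m → Z) : 0 ≤ ∏ t, w (z t) :=
  Finset.prod_nonneg fun _ _ => hw.nonneg _

theorem IsWeight.sum_prod (hw : IsWeight w) : ∑ z : Fin m → Z, ∏ t, w (z t) = 1 := by
  have h := Fintype.sum_pow w m
  rw [hw.sum_eq, one_pow] at h
  exact h.symm

theorem prodExp_const (hw : IsWeight w) (c : ℝ) : prodExp w (fun _ : Fin m → Z => c) = c := by
  rw [prodExp, ← Finset.sum_mul, hw.sum_prod, one_mul]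

theorem prodExp_mono (hw : IsWeight w) {F G : (Fin m → Z) → ℝ} (h : ∀ z, F z ≤ G z) :
    prodExp w F ≤ prodExp w G :=
  Finset.sum_le_sum fun z _ => mul_le_mul_of_nonneg_left (h z) (hw.prod_nonneg z)

theorem prodExp_prod (φ : Fin m → Z → ℝ) :
    prodExp w (fun z => ∏ t, φ t (z t)) = ∏ t, ∑ y, w y * φ t y := by
  classical
  simp only [prodExp, ← Finset.prod_mul_distrib]
  rw [Finset.prod_univ_sum]
  simp

theorem exp_prodExp_le (hw : IsWeight w) (F : (Fin m → Z) → ℝ) :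
    Real.exp (prodExp w F) ≤ prodExp w (fun z => Real.exp (F z)) := by
  have := convexOn_exp.map_sum_le (t := Finset.univ) (w := fun z : Fin m → Z => ∏ t, w (z t))
    (p := F) (fun z _ => hw.prod_nonneg z) hw.sum_prod (fun _ _ => Set.mem_univ _)
  simpa [prodExp, smul_eq_mul] using this

/-- The linear term averages to zero for a centred variable, so this serves as a Hoeffding lemma
with a weaker constant. For `x ≤ 0` it rests on `(1 + x + x²)(1 - x) = 1 - x³ ≥ 1`. -/
theorem exp_le_add_exp_sq (x : ℝ) : Real.exp x ≤ x + Real.exp (x ^ 2) := by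
  rcases le_total x 0 with hx | hx
  · have h1 : Real.exp x * Real.exp (-x) = 1 := by rw [← Real.exp_add]; simp
    have h2 := Real.add_one_le_exp (-x)
    have h3 := Real.add_one_le_exp (x ^ 2)
    have h5 : 0 ≤ x + 1 + x ^ 2 := by nlinarith [sq_nonneg (x + 1)]
    have h6 : 1 ≤ (x + 1 + x ^ 2) * (-x + 1) := by
      nlinarith [mul_nonneg (neg_nonneg.2 hx) (sq_nonneg x)]
    have h7 : Real.exp x ≤ x + 1 + x ^ 2 := by
      have : Real.exp x * Real.exp (-x) ≤ (x + 1 + x ^ 2) * Real.exp (-x) := by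
        rw [h1]
        exact h6.trans (mul_le_mul_of_nonneg_left h2 h5)
      exact le_of_mul_le_mul_right this (Real.exp_pos _)
    linarith
  · rcases le_total 1 x with h1 | h1
    · have : Real.exp x ≤ Real.exp (x ^ 2) := Real.exp_le_exp.2 (by nlinarith)
      linarith
    · have hb := Real.exp_bound' hx h1 (n := 2) (by norm_num)
      have h3 := Real.add_one_le_exp (x ^ 2)
      simp [Finset.sum_range_succ, Nat.factorial] at hb
      nlinarith

/-- Exponential moment of a centred bounded variable. -/
theorem sum_exp_centred_le (hw : IsWeight w) {G : Z → ℝ} {c : ℝ} (s : ℝ)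
    (hG : ∀ y y', |G y - G y'| ≤ c) :
    ∑ y, w y * Real.exp (s * (G y - ∑ y', w y' * G y')) ≤ Real.exp (s ^ 2 * c ^ 2) := by
  set g := ∑ y', w y' * G y' with hg
  have hcen : ∀ y, |G y - g| ≤ c := by
    intro y
    have : G y - g = ∑ y', w y' * (G y - G y') := by
      simp only [mul_sub, Finset.sum_sub_distrib, ← Finset.sum_mul, hw.sum_eq, one_mul, hg]
    rw [this]
    calc |∑ y', w y' * (G y - G y')| ≤ ∑ y', |w y' * (G y - G y')| :=
          Finset.abs_sum_le_sum_abs _ _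
      _ ≤ ∑ y', w y' * c := Finset.sum_le_sum fun y' _ => by
          rw [abs_mul, abs_of_nonneg (hw.nonneg y')]
          exact mul_le_mul_of_nonneg_left (hG y y') (hw.nonneg y')
      _ = c := by rw [← Finset.sum_mul, hw.sum_eq, one_mul]
  calc ∑ y, w y * Real.exp (s * (G y - g))
      ≤ ∑ y, w y * (s * (G y - g) + Real.exp (s ^ 2 * c ^ 2)) := by
        refine Finset.sum_le_sum fun y _ => mul_le_mul_of_nonneg_left ?_ (hw.nonneg y)
        refine (exp_le_add_exp_sq _).trans (add_le_add_right (Real.exp_le_exp.2 ?_) _)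
        rw [mul_pow]
        exact mul_le_mul_of_nonneg_left (sq_le_sq.2 ((hcen y).trans (le_abs_self c)))
          (sq_nonneg s)
    _ = s * ((∑ y, w y * G y) - (∑ y, w y) * g) + (∑ y, w y) * Real.exp (s ^ 2 * c ^ 2) := by
        simp only [mul_add, Finset.sum_add_distrib, Finset.sum_mul, ← Finset.sum_sub_distrib,
          Finset.mul_sum]
        congr 1
        exact Finset.sum_congr rfl fun y _ => by ring
    _ = Real.exp (s ^ 2 * c ^ 2) := by rw [hw.sum_eq]; simp [hg]

/-- Bounded differences: exponential moment. -/
theorem prodExp_exp_centred_le (hw : IsWeight w) {c : ℝ} (s : ℝ) (F : (Fin m → Z) → ℝ)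
    (hF : ∀ z t y, |F (Function.update z t y) - F z| ≤ c) :
    prodExp w (fun z => Real.exp (s * (F z - prodExp w F))) ≤
      Real.exp (m * (s ^ 2 * c ^ 2)) := by
  induction m with
  | zero => simp [prodExp_zero]
  | succ m ih =>
    -- `G` is the conditional expectation given the first coordinate. The deviation splits into `F -
    -- G`, handled by induction, and `G - E F`, a centred function of one coordinate.
    set G : Z → ℝ := fun y => prodExp w (fun z : Fin m → Z => F (Fin.cons y z)) with hG
    have hE : prodExp w F = ∑ y, w y * G y := prodExp_succ F
    have hrest : ∀ y, prodExp w (fun z : Fin m → Z => Real.exp (s * (F (Fin.cons y z) - G y))) ≤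
        Real.exp (m * (s ^ 2 * c ^ 2)) := fun y => by
      refine ih (fun z => F (Fin.cons y z)) fun z t y' => ?_
      rw [Fin.cons_update]
      exact hF _ _ _
    have hdiff : ∀ y y', |G y - G y'| ≤ c := fun y y' => by
      have h1 : ∀ z : Fin m → Z, |F (Fin.cons y z) - F (Fin.cons y' z)| ≤ c := fun z => by
        have := hF (Fin.cons y' z) 0 y
        rwa [Fin.update_cons_zero] at this
      rw [abs_sub_le_iff]
      constructor
      · have : G y ≤ prodExp w (fun z : Fin m → Z => F (Fin.cons y' z) + c) :=
          prodExp_mono hw fun z => by have := (abs_sub_le_iff.1 (h1 z)).1; linarith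
        rw [prodExp_add, prodExp_const hw] at this
        simp only [hG] at *; linarith
      · have : G y' ≤ prodExp w (fun z : Fin m → Z => F (Fin.cons y z) + c) :=
          prodExp_mono hw fun z => by have := (abs_sub_le_iff.1 (h1 z)).2; linarith
        rw [prodExp_add, prodExp_const hw] at this
        simp only [hG] at *; linarith
    rw [prodExp_succ, hE]
    calc ∑ y, w y * prodExp w (fun z : Fin m → Z =>
            Real.exp (s * (F (Fin.cons y z) - ∑ y', w y' * G y')))
        ≤ ∑ y, (w y * Real.exp (s * (G y - ∑ y', w y' * G y'))) *
            Real.exp (m * (s ^ 2 * c ^ 2)) := by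
          refine Finset.sum_le_sum fun y _ => ?_
          rw [mul_assoc]
          refine mul_le_mul_of_nonneg_left ?_ (hw.nonneg y)
          have : ∀ z : Fin m → Z, Real.exp (s * (F (Fin.cons y z) - ∑ y', w y' * G y')) =
              Real.exp (s * (G y - ∑ y', w y' * G y')) *
                Real.exp (s * (F (Fin.cons y z) - G y)) := fun z => by
            rw [← Real.exp_add]; ring_nf
          simp only [this, prodExp_const_mul]
          exact mul_le_mul_of_nonneg_left (hrest y) (Real.exp_pos _).le
      _ ≤ Real.exp (s ^ 2 * c ^ 2) * Real.exp (m * (s ^ 2 * c ^ 2)) := by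
          rw [← Finset.sum_mul]
          exact mul_le_mul_of_nonneg_right (sum_exp_centred_le hw s hdiff) (Real.exp_pos _).le
      _ = Real.exp ((m + 1 : ℕ) * (s ^ 2 * c ^ 2)) := by
          rw [← Real.exp_add]; push_cast; ring_nf

open Classical in
/-- Bounded differences inequality: upper tail. -/
theorem sum_prod_tail_le (hw : IsWeight w) {c : ℝ} (hc : 0 < c) (hm : 0 < m)
    (F : (Fin m → Z) → ℝ) (hF : ∀ z t y, |F (Function.update z t y) - F z| ≤ c)
    {δ : ℝ} (hδ : 0 < δ) (hδ1 : δ ≤ 1) :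
    ∑ z with prodExp w F + 2 * c * Real.sqrt (m * Real.log (1 / δ)) ≤ F z, ∏ t, w (z t) ≤ δ := by
  have hm' : (0 : ℝ) < m := Nat.cast_pos.2 hm
  set l := Real.log (1 / δ) with hl
  have hl0 : 0 ≤ l := Real.log_nonneg (by rw [le_div_iff₀ hδ]; linarith)
  set u := 2 * c * Real.sqrt (m * l) with hu
  have hu0 : 0 ≤ u := by positivity
  have hu2 : u ^ 2 = 4 * c ^ 2 * (m * l) := by
    rw [hu, mul_pow, Real.sq_sqrt (by positivity)]; ring
  -- This is the minimizer of the Chernoff exponent `-s u + m s² c²`.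
  set s := u / (2 * m * c ^ 2) with hs
  have hs0 : 0 ≤ s := by positivity
  have key := prodExp_exp_centred_le hw s F hF
  have hex : -(s * u) + m * (s ^ 2 * c ^ 2) = -l := by
    have h1 : s * u = 2 * l := by
      rw [hs, div_mul_eq_mul_div, ← sq, hu2]; field_simp; ring
    have h2 : m * (s ^ 2 * c ^ 2) = s * u / 2 := by
      rw [hs]; field_simp
    rw [h2, h1]; ring
  calc ∑ z with prodExp w F + u ≤ F z, ∏ t, w (z t)
      ≤ ∑ z with prodExp w F + u ≤ F z, Real.exp (-(s * u)) *
          ((∏ t, w (z t)) * Real.exp (s * (F z - prodExp w F))) := by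
        refine Finset.sum_le_sum fun z hz => ?_
        have hz' := (Finset.mem_filter.1 hz).2
        rw [mul_left_comm, ← Real.exp_add]
        refine le_mul_of_one_le_right (hw.prod_nonneg z) (Real.one_le_exp ?_)
        nlinarith
    _ ≤ ∑ z, Real.exp (-(s * u)) *
          ((∏ t, w (z t)) * Real.exp (s * (F z - prodExp w F))) :=
        Finset.sum_le_sum_of_subset_of_nonneg (Finset.filter_subset _ _) fun z _ _ =>
          mul_nonneg (Real.exp_pos _).le (mul_nonneg (hw.prod_nonneg z) (Real.exp_pos _).le)
    _ ≤ Real.exp (-(s * u)) * Real.exp (m * (s ^ 2 * c ^ 2)) := by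
        rw [← Finset.mul_sum]
        exact mul_le_mul_of_nonneg_left key (Real.exp_pos _).le
    _ = δ := by
        rw [← Real.exp_add, hex, hl, one_div, Real.log_inv, neg_neg, Real.exp_log hδ]

end FiniteProbability

/-! ### Symmetrization, contraction, and maxima of Rademacher sums. -/

section Rademacher

/-- The sign attached to a boolean. -/
def boolSign (b : Bool) : ℝ := if b then 1 else -1

/-- Weights `w` on `Z` together with an independent fair sign. -/
noncomputable def signedWeight {Z : Type*} (w : Z → ℝ) : Z × Bool → ℝ := fun y => w y.1 / 2

variable {Z : Type*} [Fintype Z] {w : Z → ℝ} {m : ℕ}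

theorem sum_signedWeight (φ : Z × Bool → ℝ) :
    ∑ y, signedWeight w y * φ y = ∑ y, w y * ((φ (y, true) + φ (y, false)) / 2) := by
  rw [Fintype.sum_prod_type]
  refine Finset.sum_congr rfl fun y _ => ?_
  simp only [Fintype.sum_bool, signedWeight]
  ring

theorem IsWeight.signed (hw : IsWeight w) : IsWeight (signedWeight w) where
  nonneg y := div_nonneg (hw.nonneg _) (by norm_num)
  sum_eq := by
    have := sum_signedWeight (w := w) (fun _ => 1)
    simp only [mul_one] at this
    rw [this]; norm_num [hw.sum_eq]

theorem bddAbove_range_of_finite {I : Type*} [Finite I] (f : I → ℝ) : BddAbove (Set.range f) :=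
  (Set.finite_range f).bddAbove

variable {I : Type*} [Finite I] [Nonempty I]

/-- One step of symmetrization and contraction. -/
theorem sum_iSup_centred_le (hw : IsWeight w) (H : I → ℝ) (h a : I → Z → ℝ)
    (ha : ∀ i j y, |h i y - h j y| ≤ |a i y - a j y|) :
    ∑ y, w y * (⨆ i, (H i + ((∑ y', w y' * h i y') - h i y))) ≤
      ∑ y, signedWeight w y * (⨆ i, (H i + 2 * (boolSign y.2 * a i y.1))) := by
  -- Let `i`, `j` attain the two suprema. Only `2 (h i - h j) ≤ 2 |a i - a j|` enters, and the sign
  -- of `a i - a j` decides which index takes the plus sign on the right.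
  have hstep : ∀ y, (⨆ i, (H i + 2 * h i y)) + (⨆ i, (H i - 2 * h i y)) ≤
      (⨆ i, (H i + 2 * a i y)) + (⨆ i, (H i - 2 * a i y)) := by
    intro y
    obtain ⟨i, hi⟩ := exists_eq_ciSup_of_finite (f := fun i => H i + 2 * h i y)
    obtain ⟨j, hj⟩ := exists_eq_ciSup_of_finite (f := fun i => H i - 2 * h i y)
    rw [← hi, ← hj]
    have hd := (le_abs_self _).trans (ha i j y)
    rcases abs_cases (a i y - a j y) with ⟨he, _⟩ | ⟨he, _⟩
    · have h1 := le_ciSup (bddAbove_range_of_finite fun i => H i + 2 * a i y) i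
      have h2 := le_ciSup (bddAbove_range_of_finite fun i => H i - 2 * a i y) j
      linarith
    · have h1 := le_ciSup (bddAbove_range_of_finite fun i => H i + 2 * a i y) j
      have h2 := le_ciSup (bddAbove_range_of_finite fun i => H i - 2 * a i y) i
      linarith
  -- The expression is half the mean of `H + 2h` plus half of `H - 2h` at `y`. The supremum splits
  -- along these halves, which is where the factor `2` arises; after averaging over `y` both halves
  -- can be evaluated at the same point.
  have hpt : ∀ y, (⨆ i, (H i + ((∑ y', w y' * h i y') - h i y))) ≤
      (∑ y', w y' * (⨆ i, (H i + 2 * h i y'))) / 2 + (⨆ i, (H i - 2 * h i y)) / 2 := by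
    intro y
    refine ciSup_le fun i => ?_
    have h1 : ∑ y', w y' * (H i + 2 * h i y') ≤ ∑ y', w y' * (⨆ i, (H i + 2 * h i y')) :=
      Finset.sum_le_sum fun y' _ => mul_le_mul_of_nonneg_left
        (le_ciSup (bddAbove_range_of_finite fun i => H i + 2 * h i y') i) (hw.nonneg y')
    have h2 := le_ciSup (bddAbove_range_of_finite fun i => H i - 2 * h i y) i
    have h3 : ∑ y', w y' * (H i + 2 * h i y') = H i + 2 * ∑ y', w y' * h i y' := by
      simp only [mul_add, Finset.sum_add_distrib, ← Finset.sum_mul, hw.sum_eq, one_mul,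
        Finset.mul_sum]
      congr 1
      exact Finset.sum_congr rfl fun _ _ => by ring
    linarith
  calc ∑ y, w y * (⨆ i, (H i + ((∑ y', w y' * h i y') - h i y)))
      ≤ ∑ y, w y * ((∑ y', w y' * (⨆ i, (H i + 2 * h i y'))) / 2 +
          (⨆ i, (H i - 2 * h i y)) / 2) :=
        Finset.sum_le_sum fun y _ => mul_le_mul_of_nonneg_left (hpt y) (hw.nonneg y)
    _ = ∑ y, w y * (((⨆ i, (H i + 2 * h i y)) + (⨆ i, (H i - 2 * h i y))) / 2) := by
        simp only [mul_add, Finset.sum_add_distrib, ← Finset.sum_mul, hw.sum_eq, one_mul,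
          add_div, Finset.sum_div]
        congr 1
        exact Finset.sum_congr rfl fun _ _ => by ring
    _ ≤ ∑ y, w y * (((⨆ i, (H i + 2 * a i y)) + (⨆ i, (H i - 2 * a i y))) / 2) :=
        Finset.sum_le_sum fun y _ => mul_le_mul_of_nonneg_left
          (div_le_div_of_nonneg_right (hstep y) (by norm_num)) (hw.nonneg y)
    _ = _ := by
        rw [sum_signedWeight]
        simp [boolSign, sub_eq_add_neg]

/-- Symmetrization and contraction. -/
theorem prodExp_iSup_centred_le (hw : IsWeight w) (h a : I → Z → ℝ)
    (ha : ∀ i j y, |h i y - h j y| ≤ |a i y - a j y|) (H : I → ℝ) :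
    prodExp w (fun z : Fin m → Z =>
        ⨆ i, (H i + ∑ t, ((∑ y', w y' * h i y') - h i (z t)))) ≤
      prodExp (signedWeight w) (fun z : Fin m → Z × Bool =>
        ⨆ i, (H i + 2 * ∑ t, boolSign (z t).2 * a i (z t).1)) := by
  -- The offset `H` absorbs the summands of all other coordinates while one coordinate is replaced.
  induction m generalizing H with
  | zero => simp [prodExp_zero]
  | succ m ih =>
    rw [prodExp_succ, prodExp_succ]
    simp only [Fin.sum_univ_succ, Fin.cons_zero, Fin.cons_succ]
    calc ∑ y, w y * prodExp w (fun z : Fin m → Z => ⨆ i, (H i + (((∑ y', w y' * h i y') - h i y) +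
            ∑ t, ((∑ y', w y' * h i y') - h i (z t)))))
        ≤ ∑ y, w y * prodExp (signedWeight w) (fun z : Fin m → Z × Bool =>
            ⨆ i, ((H i + ((∑ y', w y' * h i y') - h i y)) +
              2 * ∑ t, boolSign (z t).2 * a i (z t).1)) := by
          refine Finset.sum_le_sum fun y _ => mul_le_mul_of_nonneg_left ?_ (hw.nonneg y)
          simp only [← add_assoc]
          exact ih fun i => H i + ((∑ y', w y' * h i y') - h i y)
      _ = prodExp (signedWeight w) (fun z : Fin m → Z × Bool => ∑ y, w y *
            ⨆ i, ((H i + 2 * ∑ t, boolSign (z t).2 * a i (z t).1) +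
              ((∑ y', w y' * h i y') - h i y))) := by
          rw [prodExp_sum]
          refine Finset.sum_congr rfl fun y _ => ?_
          rw [← prodExp_const_mul]
          congr! 5
          ring
      _ ≤ prodExp (signedWeight w) (fun z : Fin m → Z × Bool => ∑ y, signedWeight w y *
            ⨆ i, ((H i + 2 * ∑ t, boolSign (z t).2 * a i (z t).1) +
              2 * (boolSign y.2 * a i y.1))) :=
          prodExp_mono hw.signed fun z => sum_iSup_centred_le hw _ h a ha
      _ = _ := by
          rw [prodExp_sum]
          refine Finset.sum_congr rfl fun y _ => ?_
          rw [← prodExp_const_mul]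
          congr! 5
          ring

/-- The maximum of finitely many Rademacher sums. -/
theorem prodExp_iSup_rademacher_le {J : Type*} [Fintype J] [Nonempty J] (hw : IsWeight w)
    (hm : 0 < m) (b : J → Z → ℝ) (hb : ∀ j y, |b j y| ≤ 1) {l : ℝ} (hl : 0 < l)
    (hJ : (Fintype.card J : ℝ) ≤ Real.exp l) :
    prodExp (signedWeight w) (fun z : Fin m → Z × Bool =>
        ⨆ j, ∑ t, boolSign (z t).2 * b j (z t).1) ≤ 2 * Real.sqrt (m * l) := by
  have hm' : (0 : ℝ) < m := Nat.cast_pos.2 hm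
  set M := prodExp (signedWeight w) (fun z : Fin m → Z × Bool =>
        ⨆ j, ∑ t, boolSign (z t).2 * b j (z t).1) with hM
  -- With `m s² = l` the exponent below is `3l/2`, while `s √(m l) = l`.
  set s := Real.sqrt (l / m) with hs
  have hs0 : 0 < s := Real.sqrt_pos.2 (by positivity)
  have hss : s ^ 2 * m = l := by rw [hs, Real.sq_sqrt (by positivity)]; field_simp
  have hbound : Real.exp (s * M) ≤ Real.exp (l + m * (s ^ 2 / 2)) := by
    rw [hM, ← prodExp_const_mul]
    refine (exp_prodExp_le hw.signed _).trans ?_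
    calc prodExp (signedWeight w) (fun z : Fin m → Z × Bool =>
          Real.exp (s * ⨆ j, ∑ t, boolSign (z t).2 * b j (z t).1))
        ≤ prodExp (signedWeight w) (fun z : Fin m → Z × Bool =>
          ∑ j, ∏ t, Real.exp (s * (boolSign (z t).2 * b j (z t).1))) := by
          refine prodExp_mono hw.signed fun z => ?_
          obtain ⟨j, hj⟩ := exists_eq_ciSup_of_finite
            (f := fun j => ∑ t, boolSign (z t).2 * b j (z t).1)
          rw [← hj, Finset.mul_sum, Real.exp_sum]
          exact Finset.single_le_sum (f := fun j => ∏ t, Real.exp (s * (boolSign (z t).2 *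
            b j (z t).1))) (fun j _ => Finset.prod_nonneg fun t _ => (Real.exp_pos _).le)
            (Finset.mem_univ j)
      _ ≤ ∑ j : J, Real.exp (m * (s ^ 2 / 2)) := by
          rw [prodExp_sum]
          refine Finset.sum_le_sum fun j _ => ?_
          rw [prodExp_prod (w := signedWeight w)
            (fun _ (y : Z × Bool) => Real.exp (s * (boolSign y.2 * b j y.1)))]
          rw [Finset.prod_const, Finset.card_univ, Fintype.card_fin, Real.exp_nat_mul]
          refine pow_le_pow_left₀ (Finset.sum_nonneg fun y _ =>
            mul_nonneg (hw.signed.nonneg y) (Real.exp_pos _).le) ?_ _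
          rw [sum_signedWeight]
          calc _ ≤ ∑ y, w y * Real.exp (s ^ 2 / 2) := by
                refine Finset.sum_le_sum fun y _ => mul_le_mul_of_nonneg_left ?_ (hw.nonneg y)
                have h1 := Real.cosh_le_exp_half_sq (s * b j y)
                rw [Real.cosh_eq] at h1
                have h2 : Real.exp ((s * b j y) ^ 2 / 2) ≤ Real.exp (s ^ 2 / 2) := by
                  refine Real.exp_le_exp.2 (div_le_div_of_nonneg_right ?_ (by norm_num))
                  rw [mul_pow]
                  exact mul_le_of_le_one_right (sq_nonneg s) ((sq_le_one_iff_abs_le_one _).2 (hb j y))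
                simpa [boolSign] using h1.trans h2
            _ = _ := by rw [← Finset.sum_mul, hw.sum_eq, one_mul]
      _ ≤ Real.exp (l + m * (s ^ 2 / 2)) := by
          rw [Finset.sum_const, Finset.card_univ, nsmul_eq_mul, Real.exp_add]
          exact mul_le_mul_of_nonneg_right hJ (Real.exp_pos _).le
  have h1 : s * M ≤ s * (2 * Real.sqrt (m * l)) := by
    have h2 := Real.exp_le_exp.1 hbound
    have h3 : s * Real.sqrt (m * l) = l := by
      rw [hs, ← Real.sqrt_mul (by positivity)]
      have : l / m * (m * l) = l ^ 2 := by field_simp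
      rw [this, Real.sqrt_sq hl.le]
    nlinarith
  exact le_of_mul_le_mul_left h1 hs0

end Rademacher

/-! ### The loss is Lipschitz and its relative entropy is curved. -/

section Link

/-- The logarithmic loss of the value `x` at the observed bit `b`. -/
noncomputable def logLoss (f : ℝ → ℝ) (b : Bool) (x : ℝ) : ℝ :=
  if b then Real.log (1 / f x) else Real.log (1 / (1 - f x))

variable {f : ℝ → ℝ} {α : ℝ}

theorem IsLink.pos (hf : IsLink f α) {x : ℝ} (hx : x ∈ Set.Icc (-α) α) : 0 < f x :=
  lt_of_le_of_ne (hf.mem_Icc x).1 (hf.ne_zero x hx).symm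

theorem IsLink.one_sub_pos (hf : IsLink f α) {x : ℝ} (hx : x ∈ Set.Icc (-α) α) : 0 < 1 - f x :=
  sub_pos.2 (lt_of_le_of_ne (hf.mem_Icc x).2 (hf.ne_one x hx))

theorem IsLink.deriv_pos (hf : IsLink f α) {x : ℝ} (hx : x ∈ Set.Icc (-α) α) : 0 < deriv f x :=
  lt_of_le_of_ne hf.mono.deriv_nonneg (hf.deriv_ne_zero x hx).symm

theorem IsLink.steepness_le (hf : IsLink f α) {x : ℝ} (hx : x ∈ Set.Icc (-α) α) :
    deriv f x ≤ Lconst f α * (f x * (1 - f x)) := by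
  have h : steepness f x ≤ Lconst f α := le_csSup hf.bddL ⟨x, hx, rfl⟩
  rwa [steepness, div_le_iff₀ (mul_pos (hf.pos hx) (hf.one_sub_pos hx)),
    abs_of_pos (hf.deriv_pos hx)] at h

theorem IsLink.Lconst_pos (hf : IsLink f α) {x : ℝ} (hx : x ∈ Set.Icc (-α) α) :
    0 < Lconst f α :=
  pos_of_mul_pos_left ((hf.deriv_pos hx).trans_le (hf.steepness_le hx))
    (mul_pos (hf.pos hx) (hf.one_sub_pos hx)).le

theorem IsLink.flatness_le (hf : IsLink f α) {x : ℝ} (hx : x ∈ Set.Icc (-α) α) :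
    f x * (1 - f x) ≤ betaConst f α * deriv f x ^ 2 := by
  have h : flatness f x ≤ betaConst f α := le_csSup hf.bddBeta ⟨x, hx, rfl⟩
  rwa [flatness, div_le_iff₀ (pow_pos (hf.deriv_pos hx) 2)] at h

theorem IsLink.betaConst_pos (hf : IsLink f α) {x : ℝ} (hx : x ∈ Set.Icc (-α) α) :
    0 < betaConst f α :=
  pos_of_mul_pos_left ((mul_pos (hf.pos hx) (hf.one_sub_pos hx)).trans_le (hf.flatness_le hx))
    (sq_nonneg _)

theorem IsLink.logLoss_nonneg (hf : IsLink f α) (b : Bool) {x : ℝ} (hx : x ∈ Set.Icc (-α) α) :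
    0 ≤ logLoss f b x := by
  have h1 := hf.pos hx
  have h2 := hf.one_sub_pos hx
  cases b
  · simp only [logLoss, Bool.false_eq_true, if_false]
    exact Real.log_nonneg (by rw [le_div_iff₀ h2]; linarith)
  · simp only [logLoss, if_true]
    exact Real.log_nonneg (by rw [le_div_iff₀ h1]; linarith)

/-- The losses at the two bits are nonnegative and add up to `logVar f x`. -/
theorem IsLink.logLoss_le (hf : IsLink f α) (b : Bool) {x : ℝ} (hx : x ∈ Set.Icc (-α) α) :
    logLoss f b x ≤ Uconst f α := by
  have h1 := hf.pos hx
  have h2 := hf.one_sub_pos hx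
  have hU : logVar f x ≤ Uconst f α := le_csSup hf.bddU ⟨x, hx, rfl⟩
  have hs : logLoss f true x + logLoss f false x = logVar f x := by
    simp only [logLoss, logVar, if_true, Bool.false_eq_true, if_false]
    rw [← Real.log_mul (by positivity) (by positivity), one_div_mul_one_div]
  have h3 := hf.logLoss_nonneg true hx
  have h4 := hf.logLoss_nonneg false hx
  cases b <;> linarith

theorem IsLink.Uconst_pos (hf : IsLink f α) {x : ℝ} (hx : x ∈ Set.Icc (-α) α) :
    0 < Uconst f α := by
  have h1 := hf.pos hx
  have h2 := hf.one_sub_pos hx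
  refine lt_of_lt_of_le ?_ (hf.logLoss_le true hx)
  simp only [logLoss, if_true]
  exact Real.log_pos (by rw [lt_div_iff₀ h1]; linarith)

/-- The derivative is `-f'/f` or `f'/(1 - f)`; both are at most the steepness in modulus, as `f` and
`1 - f` are at most one. -/
theorem IsLink.logLoss_lipschitz (hf : IsLink f α) (b : Bool) {x y : ℝ}
    (hx : x ∈ Set.Icc (-α) α) (hy : y ∈ Set.Icc (-α) α) :
    |logLoss f b x - logLoss f b y| ≤ Lconst f α * |x - y| := by
  have hd : ∀ z, HasDerivAt f (deriv f z) z := fun z => (hf.diff z).hasDerivAt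
  have hder : ∀ z ∈ Set.Icc (-α) α, HasDerivWithinAt (logLoss f b)
      (if b then -(deriv f z / f z) else deriv f z / (1 - f z)) (Set.Icc (-α) α) z := by
    intro z hz
    refine HasDerivAt.hasDerivWithinAt ?_
    have h1 := (hd z).log (hf.pos hz).ne'
    have h2 := ((hd z).const_sub 1).log (hf.one_sub_pos hz).ne'
    cases b
    · have h3 := h2.neg
      simp only [neg_div, neg_neg] at h3
      have e : logLoss f false = fun x => -Real.log (1 - f x) := by
        funext x; simp [logLoss]
      rw [e]
      exact h3
    · have h3 := h1.neg
      have e : logLoss f true = fun x => -Real.log (f x) := by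
        funext x; simp [logLoss]
      rw [e, if_pos rfl]
      exact h3
  refine (convex_Icc (-α) α).norm_image_sub_le_of_norm_hasDerivWithin_le hder (fun z hz => ?_) hy hx
  have h1 := hf.pos hz
  have h2 := hf.one_sub_pos hz
  have h3 := (hf.deriv_pos hz).le
  have h4 := hf.steepness_le hz
  have hL := (hf.Lconst_pos hz).le
  cases b
  · simp only [Bool.false_eq_true, if_false, Real.norm_eq_abs, abs_of_nonneg (div_nonneg h3 h2.le)]
    rw [div_le_iff₀ h2]
    refine h4.trans (mul_le_mul_of_nonneg_left ?_ hL)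
    exact mul_le_of_le_one_left h2.le (by linarith)
  · simp only [if_true, norm_neg, Real.norm_eq_abs, abs_of_nonneg (div_nonneg h3 h1.le)]
    rw [div_le_iff₀ h1]
    refine h4.trans (mul_le_mul_of_nonneg_left ?_ hL)
    exact mul_le_of_le_one_right h1.le (by linarith)

/-- The difference of the square roots of the two probabilities grows at rate `1 / (2√β)`. -/
theorem IsLink.le_sqrt_sub_sqrt (hf : IsLink f α) {x y : ℝ} (hx : x ∈ Set.Icc (-α) α)
    (hy : y ∈ Set.Icc (-α) α) (hxy : x ≤ y) :
    (y - x) ≤ 2 * √(betaConst f α) *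
      ((√(f y) - √(1 - f y)) - (√(f x) - √(1 - f x))) := by
  have hβ := hf.betaConst_pos hx
  have hd : ∀ z, HasDerivAt f (deriv f z) z := fun z => (hf.diff z).hasDerivAt
  have hder : ∀ z ∈ Set.Icc (-α) α, HasDerivAt (fun z => √(f z) - √(1 - f z))
      (deriv f z / (2 * √(f z)) - -deriv f z / (2 * √(1 - f z))) z := fun z hz =>
    ((hd z).sqrt (hf.pos hz).ne').sub (((hd z).const_sub 1).sqrt (hf.one_sub_pos hz).ne')
  have hcont : ContinuousOn (fun z => √(f z) - √(1 - f z)) (Set.Icc (-α) α) := fun z hz =>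
    (hder z hz).continuousAt.continuousWithinAt
  have key := (convex_Icc (-α) α).mul_sub_le_image_sub_of_le_deriv hcont
    (fun z hz => (hder z (interior_subset hz)).differentiableAt.differentiableWithinAt)
    (C := 1 / (2 * √(betaConst f α))) (fun z hz => ?_) x hx y hy hxy
  · rw [one_div, inv_mul_le_iff₀ (by positivity)] at key
    exact key
  · have hz := interior_subset hz
    rw [(hder z hz).deriv]
    have h1 := hf.pos hz
    have h2 := hf.one_sub_pos hz
    set a := √(f z) with ha
    set b := √(1 - f z) with hb
    set s := √(betaConst f α) with hs
    have ha0 : 0 < a := Real.sqrt_pos.2 h1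
    have hb0 : 0 < b := Real.sqrt_pos.2 h2
    have hs0 : 0 < s := Real.sqrt_pos.2 hβ
    have ha2 : a ^ 2 = f z := Real.sq_sqrt h1.le
    have hb2 : b ^ 2 = 1 - f z := Real.sq_sqrt h2.le
    have hs2 : s ^ 2 = betaConst f α := Real.sq_sqrt hβ.le
    have hD := hf.deriv_pos hz
    have hfl := hf.flatness_le hz
    rw [← hb2, ← ha2, ← hs2, ← mul_pow, ← mul_pow] at hfl
    -- The derivative is `f' (a + b) / (2ab)`. Flatness bounds `ab` by `√β f'`, and `a + b ≥ 1`
    -- because `a² + b² = 1`.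
    have hle : a * b ≤ s * deriv f z := le_of_sq_le_sq' hfl (by positivity)
    have hab : 1 ≤ a + b := by nlinarith
    have e : deriv f z / (2 * a) - -deriv f z / (2 * b) = deriv f z * (a + b) / (2 * (a * b)) := by
      field_simp; ring
    rw [e, div_le_div_iff₀ (by positivity) (by positivity)]
    nlinarith [mul_le_mul_of_nonneg_left hab (mul_pos hs0 hD).le]
where
  le_of_sq_le_sq' {a b : ℝ} (h : a ^ 2 ≤ b ^ 2) (hb : 0 ≤ b) : a ≤ b := abs_le_of_sq_le_sq' h hb |>.2

/-- The relative entropy dominates the squared Hellinger distance. -/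
theorem hellinger_le_relEntropy {a b : ℝ} (ha : 0 < a) (ha1 : 0 < 1 - a) (hb : 0 < b)
    (hb1 : 0 < 1 - b) :
    (√a - √b) ^ 2 + (√(1 - a) - √(1 - b)) ^ 2 ≤
      a * (Real.log (1 / b) - Real.log (1 / a)) +
        (1 - a) * (Real.log (1 / (1 - b)) - Real.log (1 / (1 - a))) := by
  -- This is `log t ≤ t - 1` at `t = √b / √a`. Adding the versions for `(a, b)` and `(1 - a, 1 - b)`
  -- completes the squares.
  have h : ∀ a b : ℝ, 0 < a → 0 < b →
      2 * a - 2 * (√a * √b) ≤ a * (Real.log (1 / b) - Real.log (1 / a)) := by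
    intro a b ha hb
    have h1 := Real.log_le_sub_one_of_pos (x := √b / √a) (by positivity)
    rw [Real.log_div (by positivity) (by positivity), Real.log_sqrt hb.le,
      Real.log_sqrt ha.le] at h1
    have h2 : a * (√b / √a) = √a * √b := by
      have := Real.mul_self_sqrt ha.le
      have h0 : 0 < √a := Real.sqrt_pos.2 ha
      field_simp
      rw [sq, this]
    simp only [one_div, Real.log_inv]
    nlinarith
  have h1 := h a b ha hb
  have h2 := h (1 - a) (1 - b) ha1 hb1
  nlinarith [Real.sq_sqrt ha.le, Real.sq_sqrt hb.le, Real.sq_sqrt ha1.le, Real.sq_sqrt hb1.le]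

/-- The factor is `8 = 4 · 2`: squaring the rate `2√β` gives `4β`, and `(P - Q)² ≤ 2 (P² + Q²)`. -/
theorem IsLink.sq_sub_le_relEntropy (hf : IsLink f α) {x y : ℝ} (hx : x ∈ Set.Icc (-α) α)
    (hy : y ∈ Set.Icc (-α) α) :
    (x - y) ^ 2 ≤ 8 * betaConst f α *
      (f x * (logLoss f true y - logLoss f true x) +
        (1 - f x) * (logLoss f false y - logLoss f false x)) := by
  have hβ := hf.betaConst_pos hx
  have hH := hellinger_le_relEntropy (hf.pos hx) (hf.one_sub_pos hx) (hf.pos hy) (hf.one_sub_pos hy)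
  simp only [logLoss, if_true, Bool.false_eq_true, if_false]
  refine le_trans ?_ (mul_le_mul_of_nonneg_left hH (by positivity))
  set P := √(f x) - √(f y) with hP
  set Q := √(1 - f x) - √(1 - f y) with hQ
  have hsq : (x - y) ^ 2 ≤ (2 * √(betaConst f α) * (P - Q)) ^ 2 := by
    rcases le_total x y with h | h
    · have := hf.le_sqrt_sub_sqrt hx hy h
      rw [← neg_sub y x, neg_sq, ← neg_sq (2 * _ * _)]
      refine pow_le_pow_left₀ (sub_nonneg.2 h) (this.trans_eq ?_) 2
      simp only [hP, hQ]; ring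
    · have := hf.le_sqrt_sub_sqrt hy hx h
      refine pow_le_pow_left₀ (sub_nonneg.2 h) (this.trans_eq ?_) 2
      simp only [hP, hQ]; ring
  refine hsq.trans ?_
  rw [mul_pow, mul_pow, Real.sq_sqrt hβ.le]
  nlinarith [sq_nonneg (P + Q)]

end Link

/-! ### Deviation bound for empirical risk minimizers. -/

section EmpiricalRisk

/-- The law of one observation. -/
noncomputable def obsWeight {Ω : Type*} (p : Ω → ℝ) (f : ℝ → ℝ) (T : Ω → ℝ) : Ω × Bool → ℝ :=
  fun y => p y.1 * (if y.2 then f (T y.1) else 1 - f (T y.1))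

variable {Ω : Type*} [Fintype Ω] {p : Ω → ℝ} {f : ℝ → ℝ} {α : ℝ} {T : Ω → ℝ} {m : ℕ}

theorem sum_obsWeight (φ : Ω × Bool → ℝ) :
    ∑ y, obsWeight p f T y * φ y =
      ∑ ω, p ω * (f (T ω) * φ (ω, true) + (1 - f (T ω)) * φ (ω, false)) := by
  rw [Fintype.sum_prod_type]
  refine Finset.sum_congr rfl fun y _ => ?_
  simp only [Fintype.sum_bool, obsWeight, if_true, Bool.false_eq_true, if_false]
  ring

theorem isWeight_obsWeight (hp : IsWeight p) (hf : ∀ x, f x ∈ Set.Icc (0 : ℝ) 1) :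
    IsWeight (obsWeight p f T) where
  nonneg y := by
    refine mul_nonneg (hp.nonneg _) ?_
    split_ifs
    · exact (hf _).1
    · exact sub_nonneg.2 (hf _).2
  sum_eq := by
    have := sum_obsWeight (p := p) (f := f) (T := T) (fun _ => 1)
    simp only [mul_one] at this
    rw [this]
    simpa using hp.sum_eq

theorem ciSup_sub_ciSup_le {I : Type*} [Finite I] [Nonempty I] {F G : I → ℝ} {c : ℝ}
    (h : ∀ i, F i - G i ≤ c) : (⨆ i, F i) - (⨆ i, G i) ≤ c := by
  rw [sub_le_iff_le_add]
  refine ciSup_le fun i => ?_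
  have := le_ciSup (bddAbove_range_of_finite G) i
  linarith [h i]

open Classical in
/-- Deviation bound for empirical risk minimization over a class of functions dominated by a
finite family. -/
theorem sum_prod_bad_le (hf : IsLink f α) (hp : IsWeight p) (hm : 0 < m)
    (hT : ∀ ω, T ω ∈ Set.Icc (-α) α) {J : Type*} [Fintype J] [Nonempty J] {b : J → Ω → ℝ}
    (hb : ∀ j ω, |b j ω| ≤ 1) {l : ℝ} (hl : 0 < l) (hJ : (Fintype.card J : ℝ) ≤ Real.exp l)
    {D : ℝ} (hD : 0 ≤ D) {K : Set (Ω → ℝ)} (hK : ∀ X ∈ K, ∀ ω, X ω ∈ Set.Icc (-α) α)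
    (hdom : ∀ X ∈ K, ∀ (A : Ω → ℝ) (a : ℝ), (∀ j, ∑ ω, A ω * b j ω ≤ a) →
      ∑ ω, A ω * X ω ≤ D * a)
    (hTK : T ∈ K) {δ : ℝ} (hδ : 0 < δ) (hδ1 : δ ≤ 1) :
    ∑ z : Fin m → Ω × Bool with ∃ X ∈ K,
        ∑ t, logLoss f (z t).2 (X (z t).1) ≤ ∑ t, logLoss f (z t).2 (T (z t).1) ∧
        32 * betaConst f α * (Lconst f α * D * √(l / m) +
          Uconst f α * √(Real.log (1 / δ) / m)) < ∑ ω, p ω * (T ω - X ω) ^ 2,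
      ∏ t, obsWeight p f T (z t) ≤ δ := by
  have hm' : (0 : ℝ) < m := Nat.cast_pos.2 hm
  obtain ⟨ω₀⟩ : Nonempty Ω := by
    by_contra h
    rw [not_nonempty_iff] at h
    have := hp.sum_eq
    simp at this
  have hβ := hf.betaConst_pos (hT ω₀)
  have hU := hf.Uconst_pos (hT ω₀)
  have hL := hf.Lconst_pos (hT ω₀)
  have hw : IsWeight (obsWeight p f T) := isWeight_obsWeight hp hf.mem_Icc
  set bd := 32 * betaConst f α * (Lconst f α * D * √(l / m) +
          Uconst f α * √(Real.log (1 / δ) / m)) with hbd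
  set bad : (Fin m → Ω × Bool) → (Ω → ℝ) → Prop := fun z X => X ∈ K ∧
        ∑ t, logLoss f (z t).2 (X (z t).1) ≤ ∑ t, logLoss f (z t).2 (T (z t).1) ∧
        bd < ∑ ω, p ω * (T ω - X ω) ^ 2 with hbad
  -- One candidate is chosen per outcome, a bad one whenever it exists. The supremum then runs over
  -- a finite index set instead of `K`.
  have hex : ∀ z, ∃ X ∈ K, (∃ X, bad z X) → bad z X := fun z => by
    by_cases h : ∃ X, bad z X
    · exact ⟨h.choose, h.choose_spec.1, fun _ => h.choose_spec⟩
    · exact ⟨T, hTK, fun h' => absurd h' h⟩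
  choose X hXK hX using hex
  set h : (Fin m → Ω × Bool) → Ω × Bool → ℝ :=
    fun i y => logLoss f y.2 (X i y.1) - logLoss f y.2 (T y.1) with hh
  have : Nonempty (Fin m → Ω × Bool) := ⟨fun _ => (ω₀, true)⟩
  set w := obsWeight p f T with hwdef
  set Φ : (Fin m → Ω × Bool) → ℝ := fun z =>
    ⨆ i, (0 + ∑ t, ((∑ y', w y' * h i y') - h i (z t))) with hΦ
  have hhU : ∀ i y, |h i y| ≤ Uconst f α := fun i y => by
    have h1 := hf.logLoss_nonneg y.2 (hK _ (hXK i) y.1)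
    have h2 := hf.logLoss_le y.2 (hK _ (hXK i) y.1)
    have h3 := hf.logLoss_nonneg y.2 (hT y.1)
    have h4 := hf.logLoss_le y.2 (hT y.1)
    rw [abs_le]; constructor <;> simp only [hh] <;> linarith
  have hdiff : ∀ z t y, |Φ (Function.update z t y) - Φ z| ≤ 2 * Uconst f α := by
    have hupd : ∀ (z : Fin m → Ω × Bool) (t : Fin m) (y : Ω × Bool) (i : Fin m → Ω × Bool),
        ∑ s, ((∑ y', w y' * h i y') - h i (Function.update z t y s)) =
          ∑ s, ((∑ y', w y' * h i y') - h i (z s)) + (h i (z t) - h i y) := by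
      intro z t y i
      rw [← sub_eq_iff_eq_add', ← Finset.sum_sub_distrib, Finset.sum_eq_single t]
      · simp
      · intro s _ hs
        rw [Function.update_of_ne hs, sub_self]
      · simp
    intro z t y
    have hi : ∀ i, |h i (z t) - h i y| ≤ 2 * Uconst f α := fun i => by
      have h1 := abs_le.1 (hhU i (z t))
      have h2 := abs_le.1 (hhU i y)
      rw [abs_le]; constructor <;> linarith
    rw [abs_sub_le_iff]
    constructor
    · refine ciSup_sub_ciSup_le fun i => ?_
      rw [hupd]
      have := (abs_le.1 (hi i)).2
      linarith
    · refine ciSup_sub_ciSup_le fun i => ?_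
      rw [hupd]
      have := (abs_le.1 (hi i)).1
      linarith
  have hE : prodExp w Φ ≤ 4 * Lconst f α * D * √(m * l) := by
    have h1 := prodExp_iSup_centred_le (m := m) hw h (fun i y => Lconst f α * X i y.1)
      (fun i j y => by
        rw [← mul_sub, abs_mul, abs_of_pos hL]
        simp only [hh, sub_sub_sub_cancel_right]
        exact hf.logLoss_lipschitz y.2 (hK _ (hXK i) _) (hK _ (hXK j) _)) (fun _ => 0)
    have h2 := prodExp_iSup_rademacher_le (m := m) hw hm (fun j y => b j y.1)
      (fun j y => hb j y.1) hl hJ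
    refine h1.trans ?_
    calc _ ≤ prodExp (signedWeight w) (fun z : Fin m → (Ω × Bool) × Bool =>
            (2 * Lconst f α * D) * ⨆ j, ∑ t, boolSign (z t).2 * b j (z t).1.1) := by
          refine prodExp_mono hw.signed fun z => ciSup_le fun i => ?_
          -- Collecting the signs by sampled index turns the Rademacher sum into a linear functional
          -- of the tensor, to which the domination hypothesis applies.
          set A : Ω → ℝ := fun ω => ∑ t, if (z t).1.1 = ω then boolSign (z t).2 else 0 with hA
          have hAX : ∀ Y : Ω → ℝ, ∑ ω, A ω * Y ω = ∑ t, boolSign (z t).2 * Y (z t).1.1 := by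
            intro Y
            simp only [hA, Finset.sum_mul, ite_mul, zero_mul]
            rw [Finset.sum_comm]
            simp
          have h3 := hdom _ (hXK i) A (⨆ j, ∑ t, boolSign (z t).2 * b j (z t).1.1) fun j => by
            rw [hAX]
            exact le_ciSup (bddAbove_range_of_finite
              fun j => ∑ t, boolSign (z t).2 * b j (z t).1.1) j
          rw [hAX] at h3
          have h4 : ∑ t, boolSign (z t).2 * (Lconst f α * X i (z t).1.1) =
              Lconst f α * ∑ t, boolSign (z t).2 * X i (z t).1.1 := by
            rw [Finset.mul_sum]
            exact Finset.sum_congr rfl fun _ _ => by ring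
          rw [zero_add, h4]
          nlinarith [mul_le_mul_of_nonneg_left h3 hL.le]
      _ ≤ (2 * Lconst f α * D) * (2 * √(m * l)) := by
          rw [prodExp_const_mul]
          exact mul_le_mul_of_nonneg_left h2 (by positivity)
      _ = _ := by ring
  refine le_trans (Finset.sum_le_sum_of_subset_of_nonneg ?_ fun z _ _ => hw.prod_nonneg z)
    (sum_prod_tail_le hw (c := 2 * Uconst f α) (by positivity) hm Φ hdiff hδ hδ1)
  intro z hz
  simp only [Finset.mem_filter, Finset.mem_univ, true_and] at hz ⊢
  obtain ⟨Y, hYK, hY1, hY2⟩ := hz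
  obtain ⟨-, hX1, hX2⟩ := hX z ⟨Y, hYK, hY1, hY2⟩
  have hge : ∑ t, ((∑ y', w y' * h z y') - h z (z t)) ≤ Φ z := by
    have := le_ciSup (bddAbove_range_of_finite
      fun i => (0 + ∑ t, ((∑ y', w y' * h i y') - h i (z t)))) z
    simpa only [hΦ, zero_add] using this
  have hKL : ∑ ω, p ω * (T ω - X z ω) ^ 2 ≤ 8 * betaConst f α * ∑ y', w y' * h z y' := by
    rw [hwdef, sum_obsWeight, Finset.mul_sum]
    refine Finset.sum_le_sum fun ω _ => ?_
    have := mul_le_mul_of_nonneg_left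
      (hf.sq_sub_le_relEntropy (hT ω) (hK _ (hXK z) ω)) (hp.nonneg ω)
    simp only [hh]
    linarith
  have hsum : ∑ t, ((∑ y', w y' * h z y') - h z (z t)) ≥ m * ∑ y', w y' * h z y' := by
    rw [Finset.sum_sub_distrib, Finset.sum_const, Finset.card_univ, Fintype.card_fin, nsmul_eq_mul]
    have : ∑ t, h z (z t) ≤ 0 := by
      simp only [hh, Finset.sum_sub_distrib]
      linarith
    linarith
  have hs1 : √(m * l) = m * √(l / m) := by
    rw [show m * l = m ^ 2 * (l / m) by field_simp, Real.sqrt_mul (by positivity),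
      Real.sqrt_sq hm'.le]
  have hs2 : √(m * Real.log (1 / δ)) = m * √(Real.log (1 / δ) / m) := by
    rw [show m * Real.log (1 / δ) = m ^ 2 * (Real.log (1 / δ) / m) by field_simp,
      Real.sqrt_mul (by positivity), Real.sqrt_sq hm'.le]
  rw [hs1] at hE
  rw [hs2]
  have hlt : bd < 8 * betaConst f α * ∑ y', w y' * h z y' := hX2.trans_le hKL
  -- Here `32 = 8 · 4`: the `8` is the curvature constant, and `4` occurs both in the mean bound
  -- `hE` and in the tail term `2 · (2U)`.
  have hlt2 : 4 * (Lconst f α * D * √(l / m) + Uconst f α * √(Real.log (1 / δ) / m)) <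
      ∑ y', w y' * h z y' := by
    rw [hbd] at hlt
    refine lt_of_mul_lt_mul_left (a := 8 * betaConst f α) ?_ (by positivity)
    linarith
  nlinarith [mul_lt_mul_of_pos_left hlt2 hm']

end EmpiricalRisk

/-! ### From outcome weights to the probability space; existence of minimizers. -/

section Sample

variable {d N m : ℕ} {f : ℝ → ℝ} {α : ℝ} {T : Tensor d N} {p : (Fin d → Fin N) → ℝ}

/-- The bit `±1` encoded by a boolean. -/
def boolBit (b : Bool) : ℤ := if b then 1 else -1

theorem boolBit_injective : Function.Injective boolBit := by
  intro a b h
  cases a <;> cases b <;> simp_all [boolBit]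

theorem negLogLik_eq_sum_logLoss (f : ℝ → ℝ) (z : Fin m → (Fin d → Fin N) × Bool)
    (X : Tensor d N) :
    negLogLik f (fun t => (z t).1) (fun t => boolBit (z t).2) X =
      ∑ t, logLoss f (z t).2 (X (z t).1) := by
  refine Finset.sum_congr rfl fun t _ => ?_
  rcases hb : (z t).2 <;> simp [boolBit, logLoss, hb]

theorem IsOneBitSample.measureReal_outcome {S : Type*} [MeasurableSpace S] {P : Measure S}
    [IsProbabilityMeasure P] {idx : Fin m → S → (Fin d → Fin N)} {Y : Fin m → S → ℤ}
    (h : IsOneBitSample P p f T idx Y) (z : Fin m → (Fin d → Fin N) × Bool) :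
    P.real {s | ∀ t, idx t s = (z t).1 ∧ Y t s = boolBit (z t).2} =
      ∏ t, obsWeight p f T (z t) := by
  have hind := h.indep.measure_inter_preimage_eq_mul (Finset.univ)
    (sets := fun t => {((z t).1, boolBit (z t).2)}) (fun t _ => measurableSet_singleton _)
  have hset : {s | ∀ t, idx t s = (z t).1 ∧ Y t s = boolBit (z t).2} =
      ⋂ t ∈ (Finset.univ : Finset (Fin m)), (fun s => (idx t s, Y t s)) ⁻¹'
        {((z t).1, boolBit (z t).2)} := by
    ext s
    simp
  rw [measureReal_def, hset, hind, ENNReal.toReal_prod]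
  refine Finset.prod_congr rfl fun t _ => ?_
  have hpre : (fun s => (idx t s, Y t s)) ⁻¹' {((z t).1, boolBit (z t).2)} =
      {s | idx t s = (z t).1 ∧ Y t s = boolBit (z t).2} := by
    ext s
    simp
  rw [hpre, ← measureReal_def]
  rcases hb : (z t).2 with _ | _
  · simpa [obsWeight, hb, boolBit] using h.law_neg t (z t).1
  · simpa [obsWeight, hb, boolBit] using h.law_pos t (z t).1

theorem IsOneBitSample.measurableSet_outcome {S : Type*} [MeasurableSpace S] {P : Measure S}
    {idx : Fin m → S → (Fin d → Fin N)} {Y : Fin m → S → ℤ}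
    (h : IsOneBitSample P p f T idx Y) (z : Fin m → (Fin d → Fin N) × Bool) :
    MeasurableSet {s | ∀ t, idx t s = (z t).1 ∧ Y t s = boolBit (z t).2} := by
  rw [Set.ofPred_forall]
  exact MeasurableSet.iInter fun t =>
    (h.measurable_idx t (measurableSet_singleton (z t).1)).inter
      (h.measurable_Y t (measurableSet_singleton (boolBit (z t).2)))

open Classical in
/-- A property that holds for all outcomes outside a set of small weight has large probability. -/
theorem IsOneBitSample.le_measureReal {S : Type*} [MeasurableSpace S] {P : Measure S}
    [IsProbabilityMeasure P] {idx : Fin m → S → (Fin d → Fin N)} {Y : Fin m → S → ℤ}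
    (h : IsOneBitSample P p f T idx Y) (hw : IsWeight (obsWeight p f T))
    {δ : ℝ} (bad : (Fin m → (Fin d → Fin N) × Bool) → Prop)
    (hbad : ∑ z with bad z, ∏ t, obsWeight p f T (z t) ≤ δ) (E : Set S)
    (hE : ∀ z, ¬ bad z → ∀ s, (∀ t, idx t s = (z t).1 ∧ Y t s = boolBit (z t).2) → s ∈ E) :
    1 - δ ≤ P.real E := by
  -- Neither measurability of `E` nor `Y = ±1` everywhere is needed: the disjoint measurable good
  -- outcomes inside `E` already have total weight at least `1 - δ`.
  have hsub : (⋃ z ∈ Finset.univ.filter fun z => ¬ bad z,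
      {s | ∀ t, idx t s = (z t).1 ∧ Y t s = boolBit (z t).2}) ⊆ E := by
    intro s hs
    simp only [Set.mem_iUnion, Finset.mem_filter, Finset.mem_univ, true_and] at hs
    obtain ⟨z, hz, hs⟩ := hs
    exact hE z hz s hs
  refine le_trans ?_ (measureReal_mono hsub)
  rw [measureReal_biUnion_finset ?_ fun z _ => h.measurableSet_outcome z]
  · simp only [h.measureReal_outcome]
    have := Finset.sum_filter_add_sum_filter_not Finset.univ bad
      (fun z : Fin m → (Fin d → Fin N) × Bool => ∏ t, obsWeight p f T (z t))
    rw [hw.sum_prod] at this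
    linarith
  · intro z _ z' _ hzz
    refine Set.disjoint_left.2 fun s hs hs' => hzz ?_
    funext t
    refine Prod.ext ((hs t).1.symm.trans (hs' t).1) (boolBit_injective ?_)
    exact (hs t).2.symm.trans (hs' t).2

theorem estimators_nonempty (hf : IsLink f α) {K : Set (Tensor d N)} (hK : IsCompact K)
    (hKα : ∀ X ∈ K, ∀ ω, X ω ∈ Set.Icc (-α) α) (hne : K.Nonempty)
    (idx : Fin m → (Fin d → Fin N)) (Y : Fin m → ℤ) :
    (estimators f K idx Y).Nonempty := by
  have hcont : ContinuousOn (negLogLik f idx Y) K := by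
    unfold negLogLik
    refine continuousOn_finsetSum _ fun t _ => ContinuousOn.add ?_ ?_
    · split_ifs
      · simp only [one_div, Real.log_inv]
        refine (ContinuousOn.log ?_ fun X hX => hf.ne_zero _ (hKα X hX _)).neg
        exact (hf.diff.continuous.comp (continuous_apply _)).continuousOn
      · exact continuousOn_const
    · split_ifs
      · simp only [one_div, Real.log_inv]
        refine (ContinuousOn.log ?_ fun X hX => (hf.one_sub_pos (hKα X hX _)).ne').neg
        exact (continuous_const.sub
          (hf.diff.continuous.comp (continuous_apply _))).continuousOn
      · exact continuousOn_const
  obtain ⟨X, hX, hmin⟩ := hK.exists_isMinOn hne hcont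
  exact ⟨X, hX, fun Z hZ => hmin hZ⟩

/-- Error bound for maximum likelihood estimation over a class dominated by a finite family. -/
theorem IsOneBitSample.estimators_bound {S : Type*} [MeasurableSpace S] {P : Measure S}
    [IsProbabilityMeasure P] {idx : Fin m → S → (Fin d → Fin N)} {Y : Fin m → S → ℤ}
    (h : IsOneBitSample P p f T idx Y) (hf : IsLink f α) (hp : IsWeight p) (hm : 0 < m)
    (hd : 0 < d) (hN : 0 < N)
    {J : Type*} [Fintype J] [Nonempty J] {b : J → Tensor d N}
    (hb : ∀ j ω, |b j ω| ≤ 1) {C : ℝ} (hC : 0 < C)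
    (hJ : (Fintype.card J : ℝ) ≤ Real.exp (C * (d * N)))
    {c R : ℝ} (hc : 0 ≤ c) (hR : 0 ≤ R) {K : Set (Tensor d N)} (hK : ∀ X ∈ K, ∀ ω, |X ω| ≤ α)
    (hdom : ∀ X ∈ K, ∀ (A : Tensor d N) (a : ℝ), (∀ j, ∑ ω, A ω * b j ω ≤ a) →
      ∑ ω, A ω * X ω ≤ c * R * a)
    (hTK : T ∈ K) {G : ℝ} (hG : 32 ≤ G) (hG' : 32 * (c * √C) ≤ G) {δ : ℝ} (hδ : 0 < δ) :
    1 - δ ≤ P.real {s | ∀ That ∈ estimators f K (fun t => idx t s) (fun t => Y t s),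
      sqNormPi p (T - That) ≤ G * betaConst f α *
        (Lconst f α * R * √((d : ℝ) * (N : ℝ) / (m : ℝ)) +
          Uconst f α * √(Real.log (4 / δ) / (m : ℝ)))} := by
  classical
  rcases lt_or_ge 1 δ with hδ1 | hδ1
  · exact le_trans (by linarith) measureReal_nonneg
  have hK' : ∀ X ∈ K, ∀ ω, X ω ∈ Set.Icc (-α) α := fun X hX ω => abs_le.1 (hK X hX ω)
  have hdN : (0 : ℝ) < d * N := by positivity
  have hm' : (0 : ℝ) < m := Nat.cast_pos.2 hm
  have hx := hK' T hTK (fun _ => ⟨0, hN⟩)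
  have hβ := hf.betaConst_pos hx
  have hU := hf.Uconst_pos hx
  have hL := hf.Lconst_pos hx
  refine h.le_measureReal (isWeight_obsWeight hp hf.mem_Icc) _
    (sum_prod_bad_le hf hp hm (hK' T hTK) hb (by positivity : 0 < C * (d * N)) hJ
      (mul_nonneg hc hR) hK' hdom hTK hδ hδ1) _ fun z hz s hs => ?_
  rintro X ⟨hXK, hXmin⟩
  have e1 : (fun t => idx t s) = fun t => (z t).1 := funext fun t => (hs t).1
  have e2 : (fun t => Y t s) = fun t => boolBit (z t).2 := funext fun t => (hs t).2
  have hle := hXmin T hTK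
  rw [e1, e2, negLogLik_eq_sum_logLoss, negLogLik_eq_sum_logLoss] at hle
  push Not at hz
  refine (hz X hXK hle).trans ?_
  have hlog : √(Real.log (1 / δ) / m) ≤ √(Real.log (4 / δ) / m) := by
    refine Real.sqrt_le_sqrt (div_le_div_of_nonneg_right ?_ hm'.le)
    exact Real.log_le_log (by positivity) (div_le_div_of_nonneg_right (by norm_num) hδ.le)
  have hs1 : √(C * (d * N) / m) = √C * √(d * N / m) := by
    rw [mul_div_assoc, Real.sqrt_mul hC.le]
  rw [hs1]
  have h1 : 32 * (Lconst f α * (c * R) * (√C * √(d * N / m))) ≤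
      G * (Lconst f α * R * √(d * N / m)) := by
    have := mul_le_mul_of_nonneg_right hG'
      (by positivity : 0 ≤ Lconst f α * R * √(d * N / m))
    linarith
  have h2 : 32 * (Uconst f α * √(Real.log (1 / δ) / m)) ≤
      G * (Uconst f α * √(Real.log (4 / δ) / m)) :=
    mul_le_mul hG (mul_le_mul_of_nonneg_left hlog hU.le) (by positivity) (by linarith)
  nlinarith [mul_le_mul_of_nonneg_left (add_le_add h1 h2) hβ.le]

end Sample

/-! ### Moments of sums with random isometric multipliers. -/

section RandomMultipliers

variable {E G : Type*} [NormedAddCommGroup E] [InnerProductSpace ℝ E] [Fintype G]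

/-- Moments up to order four of `∑ φ_{z_k}(b_k)` for independent random norm-preserving maps. -/
theorem prodExp_norm_sum_moments {w : G → ℝ} (hw : IsWeight w) {φ : G → E → E} {θ : ℝ}
    (hθ : 0 ≤ θ) (hnorm : ∀ y b, ‖φ y b‖ = ‖b‖) (hmean : ∀ b s, ∑ y, w y * inner ℝ (φ y b) s = 0)
    (hvar : ∀ b s, ∑ y, w y * inner ℝ (φ y b) s ^ 2 ≤ θ * (‖b‖ ^ 2 * ‖s‖ ^ 2))
    {r : ℕ} (b : Fin r → E) :
    prodExp w (fun z => ‖∑ k, φ (z k) (b k)‖ ^ 2) = ∑ k, ‖b k‖ ^ 2 ∧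
      prodExp w (fun z => ‖∑ k, φ (z k) (b k)‖ ^ 4) ≤ (1 + 2 * θ) * (∑ k, ‖b k‖ ^ 2) ^ 2 := by
  induction r with
  | zero => simp [prodExp_zero]
  | succ r ih =>
    obtain ⟨ih2, ih4⟩ := ih (fun k => b k.succ)
    have hn : ∀ y (s : E), ‖φ y (b 0) + s‖ ^ 2 =
        ‖b 0‖ ^ 2 + ‖s‖ ^ 2 + 2 * inner ℝ (φ y (b 0)) s := fun y s => by
      rw [norm_add_sq_real, hnorm]; ring
    have havg2 : ∀ s : E, ∑ y, w y * ‖φ y (b 0) + s‖ ^ 2 = ‖b 0‖ ^ 2 + ‖s‖ ^ 2 := fun s => by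
      have h1 : ∀ y, w y * ‖φ y (b 0) + s‖ ^ 2 =
          w y * (‖b 0‖ ^ 2 + ‖s‖ ^ 2) + 2 * (w y * inner ℝ (φ y (b 0)) s) := fun y => by
        rw [hn]; ring
      simp only [h1, Finset.sum_add_distrib, ← Finset.sum_mul, ← Finset.mul_sum, hw.sum_eq,
        hmean, mul_zero, add_zero, one_mul]
    have havg4 : ∀ s : E, ∑ y, w y * ‖φ y (b 0) + s‖ ^ 4 ≤
        ‖b 0‖ ^ 4 + (2 + 4 * θ) * ‖b 0‖ ^ 2 * ‖s‖ ^ 2 + ‖s‖ ^ 4 := fun s => by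
      have h1 : ∀ y, w y * ‖φ y (b 0) + s‖ ^ 4 =
          w y * (‖b 0‖ ^ 2 + ‖s‖ ^ 2) ^ 2 +
            (4 * (‖b 0‖ ^ 2 + ‖s‖ ^ 2)) * (w y * inner ℝ (φ y (b 0)) s) +
            4 * (w y * inner ℝ (φ y (b 0)) s ^ 2) := fun y => by
        rw [show ‖φ y (b 0) + s‖ ^ 4 = (‖φ y (b 0) + s‖ ^ 2) ^ 2 by ring, hn]; ring
      simp only [h1, Finset.sum_add_distrib, ← Finset.sum_mul, ← Finset.mul_sum, hw.sum_eq,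
        hmean, mul_zero, add_zero, one_mul]
      have := hvar (b 0) s
      linarith
    simp only [prodExp_succ, Fin.sum_univ_succ, Fin.cons_zero, Fin.cons_succ, ← prodExp_const_mul,
      ← prodExp_sum, havg2]
    constructor
    · rw [prodExp_add, prodExp_const hw, ih2]
    · refine (prodExp_mono hw fun z => havg4 _).trans ?_
      rw [prodExp_add, prodExp_add, prodExp_const hw, prodExp_const_mul, ih2]
      set σ := ∑ k : Fin r, ‖b k.succ‖ ^ 2
      -- The cross coefficient `2 + 4θ` is exactly twice `1 + 2θ`, so only the slack `2θ ‖b 0‖⁴`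
      -- remains.
      nlinarith [mul_nonneg hθ (sq_nonneg (‖b 0‖ ^ 2))]

end RandomMultipliers

/-! ### Quaternion units and their Khintchine inequality. -/

section Quaternion

open scoped Quaternion

/-- The quaternion unit `i`. -/
def quatI : ℍ[ℝ] := ⟨0, 1, 0, 0⟩

/-- The quaternion unit `j`. -/
def quatJ : ℍ[ℝ] := ⟨0, 0, 1, 0⟩

/-- The quaternion unit `k`. -/
def quatK : ℍ[ℝ] := ⟨0, 0, 0, 1⟩

theorem quatI_coords : quatI.re = 0 ∧ quatI.imI = 1 ∧ quatI.imJ = 0 ∧ quatI.imK = 0 :=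
  ⟨rfl, rfl, rfl, rfl⟩

theorem quatJ_coords : quatJ.re = 0 ∧ quatJ.imI = 0 ∧ quatJ.imJ = 1 ∧ quatJ.imK = 0 :=
  ⟨rfl, rfl, rfl, rfl⟩

theorem quatK_coords : quatK.re = 0 ∧ quatK.imI = 0 ∧ quatK.imJ = 0 ∧ quatK.imK = 1 :=
  ⟨rfl, rfl, rfl, rfl⟩

/-- The basis quaternions. -/
def quatBasis : Fin 4 → ℍ[ℝ] := ![1, quatI, quatJ, quatK]

/-- The four real coordinates of a quaternion. -/
def quatCoord (q : ℍ[ℝ]) : Fin 4 → ℝ := ![q.re, q.imI, q.imJ, q.imK]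

theorem norm_quat_sq (q : ℍ[ℝ]) : ‖q‖ ^ 2 = q.re ^ 2 + q.imI ^ 2 + q.imJ ^ 2 + q.imK ^ 2 := by
  rw [sq, ← Quaternion.normSq_eq_norm_mul_self, Quaternion.normSq_def']

theorem norm_quatBasis (c : Fin 4) : ‖quatBasis c‖ = 1 := by
  have : ‖quatBasis c‖ ^ 2 = 1 := by
    rw [norm_quat_sq]
    fin_cases c <;> simp [quatBasis, quatI_coords, quatJ_coords, quatK_coords]
  exact (pow_eq_one_iff_of_nonneg (norm_nonneg _) two_ne_zero).1 this

theorem abs_quatCoord_le (q : ℍ[ℝ]) (c : Fin 4) : |quatCoord q c| ≤ ‖q‖ := by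
  refine abs_le_of_sq_le_sq ?_ (norm_nonneg q)
  rw [norm_quat_sq]
  fin_cases c <;> simp [quatCoord] <;> nlinarith [sq_nonneg q.re, sq_nonneg q.imI,
    sq_nonneg q.imJ, sq_nonneg q.imK]

theorem sum_quatCoord_smul (q : ℍ[ℝ]) : ∑ c, quatCoord q c • quatBasis c = q := by
  ext <;> simp [Fin.sum_univ_four, quatCoord, quatBasis, quatI_coords, quatJ_coords,
    quatK_coords]

theorem norm_le_sum_quatCoord (q : ℍ[ℝ]) : ‖q‖ ≤ ∑ c, |quatCoord q c| := by
  conv_lhs => rw [← sum_quatCoord_smul q]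
  refine (norm_sum_le _ _).trans (Finset.sum_le_sum fun c _ => ?_)
  rw [norm_smul, norm_quatBasis, mul_one, Real.norm_eq_abs]

/-- The uniform distribution on the eight quaternion units `±1, ±i, ±j, ±k`. -/
noncomputable def unitWeight : Fin 4 × Bool → ℝ := signedWeight fun _ => 1 / 4

/-- The quaternion units `±1, ±i, ±j, ±k`. -/
noncomputable def quatUnit (y : Fin 4 × Bool) : ℍ[ℝ] := boolSign y.2 • quatBasis y.1

theorem isWeight_unitWeight : IsWeight unitWeight :=
  IsWeight.signed ⟨fun _ => by norm_num, by simp⟩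

theorem norm_quatUnit (y : Fin 4 × Bool) : ‖quatUnit y‖ = 1 := by
  rw [quatUnit, norm_smul, norm_quatBasis, mul_one]
  rcases y with ⟨c, _ | _⟩ <;> simp [boolSign]

/-- Khintchine's inequality for quaternion units, with a constant smaller than `√2`. -/
theorem sqrt_sum_norm_sq_le {r : ℕ} (b : Fin r → ℍ[ℝ]) :
    √(∑ k, ‖b k‖ ^ 2) ≤
      √(3 / 2) * prodExp unitWeight (fun z => ‖∑ k, quatUnit (z k) * b k‖) := by
  obtain ⟨h2, h4⟩ := prodExp_norm_sum_moments isWeight_unitWeight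
    -- Up to sign, the products of the units with `b` form an orthogonal basis of `ℝ⁴` with vectors
    -- of length `‖b‖`, so Parseval gives `θ = 1/4` and the fourth moment constant `1 + 2θ = 3/2`.
    (φ := fun y b => quatUnit y * b) (θ := 1 / 4) (by norm_num)
    (fun y b => by rw [norm_mul, norm_quatUnit, one_mul])
    (fun b s => by
      rw [unitWeight, sum_signedWeight]
      simp [quatUnit, boolSign, inner_neg_left])
    (fun b s => by
      rw [unitWeight, sum_signedWeight]
      simp only [quatUnit, boolSign, if_true, Bool.false_eq_true, if_false, one_smul, neg_smul,
        neg_mul, inner_neg_left, norm_quat_sq, Fin.sum_univ_four]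
      simp [quatBasis, Quaternion.inner_def, quatI_coords, quatJ_coords, quatK_coords]
      refine le_of_eq ?_
      ring) b
  set σ := ∑ k, ‖b k‖ ^ 2 with hσ
  set e := prodExp unitWeight (fun z => ‖∑ k, quatUnit (z k) * b k‖) with he
  have hσ0 : 0 ≤ σ := Finset.sum_nonneg fun k _ => sq_nonneg _
  rcases hσ0.eq_or_lt with h0 | hpos
  · rw [← h0, Real.sqrt_zero]
    refine mul_nonneg (Real.sqrt_nonneg _) ?_
    rw [← prodExp_const (m := r) isWeight_unitWeight 0]
    exact prodExp_mono isWeight_unitWeight fun z => norm_nonneg _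
  set u := √(3 / 2 * σ) with hu
  have hu0 : 0 < u := Real.sqrt_pos.2 (by positivity)
  have hu2 : u ^ 2 = 3 / 2 * σ := Real.sq_sqrt (by positivity)
  -- A pointwise substitute for Hölder interpolation of the second moment between the first and the
  -- fourth; the choice `u² = 3σ/2` loses nothing.
  have hpt : ∀ x : ℝ, 0 ≤ x → 3 * u ^ 2 * x ^ 2 ≤ 2 * u ^ 3 * x + x ^ 4 := fun x hx => by
    have : 0 ≤ x * ((x - u) ^ 2 * (x + 2 * u)) := by positivity
    linarith [this, show x * ((x - u) ^ 2 * (x + 2 * u)) =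
      2 * u ^ 3 * x + x ^ 4 - 3 * u ^ 2 * x ^ 2 by ring]
  have key := prodExp_mono isWeight_unitWeight
    (F := fun z : Fin r → _ => 3 * u ^ 2 * ‖∑ k, quatUnit (z k) * b k‖ ^ 2)
    (G := fun z => 2 * u ^ 3 * ‖∑ k, quatUnit (z k) * b k‖ + ‖∑ k, quatUnit (z k) * b k‖ ^ 4)
    (fun z => hpt _ (norm_nonneg _))
  rw [prodExp_add, prodExp_const_mul, prodExp_const_mul, h2] at key
  have h5 : σ ≤ u * e := by
    have e3 : u ^ 3 = 3 / 2 * σ * u := by rw [pow_succ, hu2]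
    rw [e3, hu2] at key
    refine le_of_mul_le_mul_left (a := σ) ?_ hpos
    nlinarith
  rw [hu, Real.sqrt_mul (by norm_num)] at h5
  have hs : 0 < √σ := Real.sqrt_pos.2 hpos
  refine le_of_mul_le_mul_left (a := √σ) ?_ hs
  rw [Real.mul_self_sqrt hσ0]
  linarith

end Quaternion

/-! ### Grothendieck's inequality by truncation of Rademacher sums. -/

section Grothendieck

/-- The fair coin. -/
noncomputable def coinWeight : Bool → ℝ := fun _ => 1 / 2

theorem isWeight_coinWeight : IsWeight coinWeight :=
  ⟨fun _ => by norm_num [coinWeight], by norm_num [coinWeight]⟩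

/-- The Rademacher sum with coefficients `x`. -/
def radSum {r : ℕ} (x : Fin r → ℝ) (z : Fin r → Bool) : ℝ := ∑ k, boolSign (z k) * x k

theorem prodExp_radSum_sq {r : ℕ} (x : Fin r → ℝ) :
    prodExp coinWeight (fun z => radSum x z ^ 2) = ∑ k, x k ^ 2 ∧
      prodExp coinWeight (fun z => radSum x z ^ 4) ≤ 3 * (∑ k, x k ^ 2) ^ 2 := by
  have := prodExp_norm_sum_moments (E := ℝ) isWeight_coinWeight
    (φ := fun y b => boolSign y * b) (θ := 1) (by norm_num)
    (fun y b => by cases y <;> simp [boolSign])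
    (fun b s => by simp [boolSign, coinWeight])
    (fun b s => by
      simp [boolSign, coinWeight, mul_pow]
      refine le_of_eq ?_; ring) x
  norm_num [Even.pow_abs] at this
  exact this

theorem prodExp_radSum_mul {r : ℕ} (x y : Fin r → ℝ) :
    prodExp coinWeight (fun z => radSum x z * radSum y z) = ∑ k, x k * y k := by
  have h1 := (prodExp_radSum_sq (fun k => x k + y k)).1
  have h2 := (prodExp_radSum_sq x).1
  have h3 := (prodExp_radSum_sq y).1
  have e : ∀ z, radSum (fun k => x k + y k) z ^ 2 =
      2 * (radSum x z * radSum y z) + radSum x z ^ 2 + radSum y z ^ 2 := fun z => by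
    have : radSum (fun k => x k + y k) z = radSum x z + radSum y z := by
      simp [radSum, mul_add, Finset.sum_add_distrib]
    rw [this]; ring
  simp only [e] at h1
  rw [prodExp_add, prodExp_add, prodExp_const_mul, h2, h3] at h1
  have e2 : ∑ k, (x k + y k) ^ 2 = 2 * ∑ k, x k * y k + ∑ k, x k ^ 2 + ∑ k, y k ^ 2 := by
    rw [Finset.mul_sum, ← Finset.sum_add_distrib, ← Finset.sum_add_distrib]
    exact Finset.sum_congr rfl fun _ _ => by ring
  linarith

/-- Truncation at level `2`. -/
noncomputable def clip (x : ℝ) : ℝ := max (-2) (min 2 x)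

theorem abs_clip_le (x : ℝ) : |clip x| ≤ 2 :=
  abs_le.2 ⟨le_max_left _ _, max_le (by norm_num) (min_le_left _ _)⟩

theorem clip_sq_le (x : ℝ) : clip x ^ 2 ≤ x ^ 2 := by
  unfold clip
  rcases le_total 2 x with h | h
  · rw [min_eq_left h, max_eq_right (by norm_num)]; nlinarith
  · rw [min_eq_right h]
    rcases le_total (-2) x with h' | h'
    · rw [max_eq_right h']
    · rw [max_eq_left h']; nlinarith

/-- Beyond the truncation level, `|x| - 2 ≤ x²/8` is `(|x| - 4)² ≥ 0`. The truncation error is thus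
controlled by the fourth moment. -/
theorem sub_clip_sq_le (x : ℝ) : (x - clip x) ^ 2 ≤ x ^ 4 / 64 := by
  unfold clip
  rcases le_total 2 x with h | h
  · rw [min_eq_left h, max_eq_right (by norm_num)]
    have : x - 2 ≤ x ^ 2 / 8 := by nlinarith [sq_nonneg (x - 4)]
    have := pow_le_pow_left₀ (by linarith) this 2
    linarith [show (x ^ 2 / 8) ^ 2 = x ^ 4 / 64 by ring]
  · rw [min_eq_right h]
    rcases le_total (-2) x with h' | h'
    · rw [max_eq_right h', sub_self, zero_pow two_ne_zero]; positivity
    · rw [max_eq_left h']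
      have : -x - 2 ≤ x ^ 2 / 8 := by nlinarith [sq_nonneg (x + 4)]
      have := pow_le_pow_left₀ (by linarith) this 2
      linarith [show (x ^ 2 / 8) ^ 2 = x ^ 4 / 64 by ring,
        show (-x - 2) ^ 2 = (x - -2) ^ 2 by ring]

variable {E ι : Type*} [NormedAddCommGroup E] [NormedSpace ℝ E] [Fintype ι]

/-- The bilinear form with vector coefficients `A` at Gram matrices of `x` and `y`. -/
def gramForm {κ : Type*} [Fintype κ] (A : ι → ι → E) (x y : ι → κ → ℝ) : E :=
  ∑ i, ∑ j, (∑ k, x i k * y j k) • A i j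

/-- Grothendieck's inequality with vector coefficients. -/
theorem norm_gramForm_le {A : ι → ι → E} {a : ℝ}
    (hA : ∀ s t : ι → ℝ, (∀ i, |s i| ≤ 1) → (∀ j, |t j| ≤ 1) →
      ‖∑ i, ∑ j, (s i * t j) • A i j‖ ≤ a)
    {r : ℕ} {x y : ι → Fin r → ℝ} (hx : ∀ i, ∑ k, x i k ^ 2 ≤ 1) (hy : ∀ j, ∑ k, y j k ^ 2 ≤ 1) :
    ‖gramForm A x y‖ ≤ 8 * a := by
  set S : Set ℝ := {v | ∃ (r : ℕ) (x y : ι → Fin r → ℝ), (∀ i, ∑ k, x i k ^ 2 ≤ 1) ∧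
    (∀ j, ∑ k, y j k ^ 2 ≤ 1) ∧ v = ‖gramForm A x y‖} with hS
  -- Finiteness of the supremum, with the bound depending on `A`, is what allows the
  -- self-referential inequality `hstep` to be solved for it.
  have hbdd : BddAbove S := by
    refine ⟨∑ i, ∑ j, ‖A i j‖, ?_⟩
    rintro v ⟨r, x, y, hx, hy, rfl⟩
    refine (norm_sum_le _ _).trans (Finset.sum_le_sum fun i _ => (norm_sum_le _ _).trans
      (Finset.sum_le_sum fun j _ => ?_))
    rw [norm_smul]
    refine mul_le_of_le_one_left (norm_nonneg _) ?_
    rw [Real.norm_eq_abs]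
    refine abs_le_of_sq_le_sq ?_ zero_le_one |>.trans_eq rfl
    rw [one_pow]
    exact (Finset.sum_mul_sq_le_sq_mul_sq _ _ _).trans
      (mul_le_one₀ (hx i) (Finset.sum_nonneg fun _ _ => sq_nonneg _) (hy j))
  -- The supremum covers all dimensions, so it also bounds the error terms below, whose vectors are
  -- indexed by sign patterns.
  have hgen : ∀ (κ : Type) [Fintype κ] (x y : ι → κ → ℝ), (∀ i, ∑ k, x i k ^ 2 ≤ 1) →
      (∀ j, ∑ k, y j k ^ 2 ≤ 1) → ‖gramForm A x y‖ ≤ sSup S := by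
    intro κ _ x y hx hy
    set e := (Fintype.equivFin κ).symm
    refine le_csSup hbdd ⟨Fintype.card κ, fun i k => x i (e k), fun i k => y i (e k),
      fun i => ?_, fun j => ?_, ?_⟩
    · rw [e.sum_comp fun k => x i k ^ 2]; exact hx i
    · rw [e.sum_comp fun k => y j k ^ 2]; exact hy j
    · simp only [gramForm]
      congr! 5 with i _ j
      exact (e.sum_comp fun k => x i k * y j k).symm
  have hstep : ∀ v ∈ S, v ≤ 4 * a + sSup S / 2 := by
    rintro v ⟨r, x, y, hx, hy, rfl⟩
    set W : (Fin r → Bool) → ℝ := fun z => ∏ t, coinWeight (z t) with hW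
    have hW0 : ∀ z, 0 ≤ W z := fun z => isWeight_coinWeight.prod_nonneg z
    set u : ι → (Fin r → Bool) → ℝ := fun i => radSum (x i) with hu
    set v : ι → (Fin r → Bool) → ℝ := fun j => radSum (y j) with hv
    -- The scaling `4` is admissible because `16 · 3/64 = 3/4 ≤ 1`; it makes each error term a
    -- quarter of a Gram form.
    have htail : ∀ x : Fin r → ℝ, ∑ k, x k ^ 2 ≤ 1 →
        ∑ z, (√(W z) * (4 * (radSum x z - clip (radSum x z)))) ^ 2 ≤ 1 := by
      intro x hx
      calc ∑ z, (√(W z) * (4 * (radSum x z - clip (radSum x z)))) ^ 2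
          ≤ ∑ z, W z * (1 / 4 * radSum x z ^ 4) := by
            refine Finset.sum_le_sum fun z _ => ?_
            rw [mul_pow, Real.sq_sqrt (hW0 z)]
            refine mul_le_mul_of_nonneg_left ?_ (hW0 z)
            have := sub_clip_sq_le (radSum x z)
            nlinarith
        _ ≤ 1 / 4 * (3 * (∑ k, x k ^ 2) ^ 2) := by
            have := prodExp_const_mul (w := coinWeight) (1 / 4) fun z => radSum x z ^ 4
            rw [prodExp] at this
            rw [this]
            exact mul_le_mul_of_nonneg_left (prodExp_radSum_sq x).2 (by norm_num)
        _ ≤ 1 := by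
            have := pow_le_one₀ (n := 2) (Finset.sum_nonneg fun k _ => sq_nonneg (x k)) hx
            linarith
    have hfull : ∀ x : Fin r → ℝ, ∑ k, x k ^ 2 ≤ 1 → ∑ z, (√(W z) * radSum x z) ^ 2 ≤ 1 := by
      intro x hx
      refine le_trans (le_of_eq ?_) hx
      rw [← (prodExp_radSum_sq x).1, prodExp]
      exact Finset.sum_congr rfl fun z _ => by rw [mul_pow, Real.sq_sqrt (hW0 z)]
    have hclip : ∀ x : Fin r → ℝ, ∑ k, x k ^ 2 ≤ 1 → ∑ z, (√(W z) * clip (radSum x z)) ^ 2 ≤ 1 := by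
      intro x hx
      refine le_trans (Finset.sum_le_sum fun z _ => ?_) (hfull x hx)
      rw [mul_pow, mul_pow]
      exact mul_le_mul_of_nonneg_left (clip_sq_le _) (sq_nonneg _)
    -- The inner product of `x i` and `y j` is the mean of `u v`, and `u v = c c' + (u - c) v + c (v
    -- - c')` with truncations `c`, `c'`. The first part averages scalar instances, as `c/2` and
    -- `c'/2` lie in `[-1, 1]`.
    have hdec : gramForm A x y =
        (∑ z, (4 * W z) • ∑ i, ∑ j, ((clip (u i z) / 2) * (clip (v j z) / 2)) • A i j) +
        (1 / 4 : ℝ) • gramForm A (fun i z => √(W z) * (4 * (u i z - clip (u i z))))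
          (fun j z => √(W z) * v j z) +
        (1 / 4 : ℝ) • gramForm A (fun i z => √(W z) * clip (u i z))
          (fun j z => √(W z) * (4 * (v j z - clip (v j z)))) := by
      simp only [gramForm, Finset.smul_sum, smul_smul]
      have hcomm : ∑ z, ∑ i, ∑ j, (4 * W z * (clip (u i z) / 2 * (clip (v j z) / 2))) • A i j =
          ∑ i, ∑ j, (∑ z, 4 * W z * (clip (u i z) / 2 * (clip (v j z) / 2))) • A i j := by
        rw [Finset.sum_comm]
        refine Finset.sum_congr rfl fun i _ => ?_
        rw [Finset.sum_comm]
        exact Finset.sum_congr rfl fun j _ => (Finset.sum_smul).symm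
      rw [hcomm, ← Finset.sum_add_distrib, ← Finset.sum_add_distrib]
      refine Finset.sum_congr rfl fun i _ => ?_
      rw [← Finset.sum_add_distrib, ← Finset.sum_add_distrib]
      refine Finset.sum_congr rfl fun j _ => ?_
      rw [← add_smul, ← add_smul, ← prodExp_radSum_mul, prodExp, Finset.mul_sum, Finset.mul_sum,
        ← Finset.sum_add_distrib, ← Finset.sum_add_distrib]
      congr 1
      refine Finset.sum_congr rfl fun z _ => ?_
      have hsq := Real.mul_self_sqrt (hW0 z)
      simp only [hu, hv] at *
      linear_combination (-(radSum (x i) z * radSum (y j) z -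
        clip (radSum (x i) z) * clip (radSum (y j) z))) * hsq
    rw [hdec]
    refine (norm_add_le _ _).trans ((add_le_add ((norm_add_le _ _).trans (add_le_add
      (b := 4 * a) (d := sSup S / 4) ?_ ?_)) (b := _) (d := sSup S / 4) ?_).trans (by linarith))
    · refine (norm_sum_le _ _).trans ?_
      calc ∑ z, ‖(4 * W z) • ∑ i, ∑ j, ((clip (u i z) / 2) * (clip (v j z) / 2)) • A i j‖
          ≤ ∑ z, W z * (4 * a) := by
            refine Finset.sum_le_sum fun z _ => ?_
            rw [norm_smul, Real.norm_eq_abs, abs_of_nonneg (mul_nonneg (by norm_num) (hW0 z)),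
              mul_comm 4, mul_assoc]
            refine mul_le_mul_of_nonneg_left (mul_le_mul_of_nonneg_left ?_ (by norm_num)) (hW0 z)
            refine hA _ _ (fun i => ?_) fun j => ?_
            · rw [abs_div, abs_two, div_le_one (by norm_num)]; exact abs_clip_le _
            · rw [abs_div, abs_two, div_le_one (by norm_num)]; exact abs_clip_le _
        _ = 4 * a := by rw [← Finset.sum_mul, isWeight_coinWeight.sum_prod, one_mul]
    · rw [norm_smul]
      have := hgen _ _ _ (fun i => htail (x i) (hx i)) (fun j => hfull (y j) (hy j))
      norm_num
      linarith
    · rw [norm_smul]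
      have := hgen _ _ _ (fun i => hclip (x i) (hx i)) (fun j => htail (y j) (hy j))
      norm_num
      linarith
  have hne : S.Nonempty := ⟨_, r, x, y, hx, hy, rfl⟩
  have h1 := csSup_le hne hstep
  have h2 := le_csSup hbdd ⟨r, x, y, hx, hy, rfl⟩
  linarith

end Grothendieck

/-! ### Multilinear Grothendieck inequality over the quaternions. -/

section QuaternionForm

open scoped Quaternion

variable {N : ℕ} {V : Type*} {val : V → ℍ[ℝ]}

/-- A linear map on a power of the quaternions is controlled by its values on a net of the ball. -/
theorem norm_le_of_net (hnet : ∀ u : ℍ[ℝ], ‖u‖ ≤ 1 → ∃ v, ‖u - val v‖ ≤ 1 / 10)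
    (g : (Fin N → ℍ[ℝ]) →ₗ[ℝ] ℍ[ℝ]) {b : ℝ}
    (hb : ∀ v : Fin N → V, ‖g fun i => val (v i)‖ ≤ b) {u : Fin N → ℍ[ℝ]}
    (hu : ∀ i, ‖u i‖ ≤ 1) : ‖g u‖ ≤ 10 / 9 * b := by
  obtain ⟨v₀, -⟩ := hnet 0 (by simp)
  have hb0 : 0 ≤ b := (norm_nonneg _).trans (hb fun _ => v₀)
  set L := LinearMap.toContinuousLinearMap g with hL
  have hgL : ∀ x, L x = g x := fun _ => rfl
  have hball : ∀ x : Fin N → ℍ[ℝ], (∀ i, ‖x i‖ ≤ 1) → ‖L x‖ ≤ b + ‖L‖ / 10 := by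
    intro x hx
    choose v hv using fun i => hnet (x i) (hx i)
    have h1 : L x = L (fun i => val (v i)) + L (x - fun i => val (v i)) := by
      rw [← map_add]; congr 1; abel
    rw [h1]
    refine (norm_add_le _ _).trans (add_le_add (hb v) ((L.le_opNorm _).trans ?_))
    have h2 : ‖x - fun i => val (v i)‖ ≤ 1 / 10 :=
      (pi_norm_le_iff_of_nonneg (by norm_num)).2 fun i => hv i
    have := mul_le_mul_of_nonneg_left h2 (norm_nonneg L)
    linarith
  -- The net bounds the operator norm for the sup norm by `b` plus a tenth of itself, hence the
  -- factor `10/9`.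
  have hop : ‖L‖ ≤ b + ‖L‖ / 10 := by
    refine ContinuousLinearMap.opNorm_le_of_unit_norm
      (add_nonneg hb0 (by positivity)) fun x hx => hball x fun i => ?_
    exact (norm_le_pi_norm x i).trans hx.le
  have := hball u hu
  rw [hgL] at this
  linarith

/-- The form `∑_ω ∑_k ∏_j x_j(ω_j, k) ρ_k A_ω`. -/
noncomputable def quatForm {d r : ℕ} (A : (Fin d → Fin N) → ℍ[ℝ])
    (x : Fin d → Fin N → Fin r → ℝ) (ρ : Fin r → ℍ[ℝ]) : ℍ[ℝ] :=
  ∑ ω, ∑ k, (∏ j, x j (ω j) k) • (ρ k * A ω)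

/-- The pairing of `A` with the rank-one quaternion tensor with factors `u_j`. -/
noncomputable def quatPairing {d : ℕ} (A : (Fin d → Fin N) → ℍ[ℝ])
    (u : Fin d → Fin N → ℍ[ℝ]) : ℍ[ℝ] :=
  ∑ ω, A ω * (List.ofFn fun j => u j (ω j)).prod

/-- Partial contraction of `A` in the first variable. -/
noncomputable def contractFirst {d : ℕ} (A : (Fin (d + 1) → Fin N) → ℍ[ℝ]) (u : Fin N → ℍ[ℝ]) :
    (Fin d → Fin N) → ℍ[ℝ] :=
  fun ω => ∑ i, A (Fin.cons i ω) * u i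

theorem quatPairing_contractFirst {d : ℕ} (A : (Fin (d + 1) → Fin N) → ℍ[ℝ]) (u : Fin N → ℍ[ℝ])
    (v : Fin d → Fin N → ℍ[ℝ]) :
    quatPairing (contractFirst A u) v = quatPairing A (Fin.cons u v) := by
  simp only [quatPairing, contractFirst, sum_fin_succ_pi, List.ofFn_succ, Fin.cons_zero,
    Fin.cons_succ, List.prod_cons, Finset.sum_mul]
  rw [Finset.sum_comm]
  simp only [mul_assoc]

/-- The multipliers `ρ` act from the left and `u` from the right, so noncommutativity does no harm.
-/
theorem quatForm_contractFirst {d r : ℕ} (A : (Fin (d + 1) → Fin N) → ℍ[ℝ]) (u : Fin N → ℍ[ℝ])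
    (x : Fin d → Fin N → Fin r → ℝ) (ρ : Fin r → ℍ[ℝ]) :
    quatForm (contractFirst A u) x ρ = ∑ i, quatForm (fun ω => A (Fin.cons i ω)) x ρ * u i := by
  simp only [quatForm, contractFirst, Finset.sum_mul, Finset.mul_sum, Finset.smul_sum]
  rw [Finset.sum_comm]
  simp only [smul_mul_assoc, mul_assoc]
  conv_rhs => rw [Finset.sum_comm]
  rw [Finset.sum_comm]
  refine Finset.sum_congr rfl fun ω _ => ?_
  rw [Finset.sum_comm]

/-- The linear map `u ↦ ∑ C_i u_i`. -/
noncomputable def rightMulSum (C : Fin N → ℍ[ℝ]) : (Fin N → ℍ[ℝ]) →ₗ[ℝ] ℍ[ℝ] where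
  toFun u := ∑ i, C i * u i
  map_add' u v := by simp [mul_add, Finset.sum_add_distrib]
  map_smul' c u := by simp [Finset.smul_sum]

/-- Duality: the test vector `u_i = ‖C_i‖⁻¹ star C_i` recovers the sum of norms. It is zero where
`C_i = 0`, by the convention for inverses. -/
theorem sum_norm_le_of_net (hnet : ∀ u : ℍ[ℝ], ‖u‖ ≤ 1 → ∃ v, ‖u - val v‖ ≤ 1 / 10)
    (C : Fin N → ℍ[ℝ]) {b : ℝ} (hb : ∀ v : Fin N → V, ‖∑ i, C i * val (v i)‖ ≤ b) :
    ∑ i, ‖C i‖ ≤ 10 / 9 * b := by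
  set u : Fin N → ℍ[ℝ] := fun i => ‖C i‖⁻¹ • star (C i) with hu
  have hu1 : ∀ i, ‖u i‖ ≤ 1 := fun i => by
    simp only [hu, norm_smul, norm_inv, norm_norm, norm_star]
    exact inv_mul_le_one
  have h := norm_le_of_net hnet (rightMulSum C) hb hu1
  have he : rightMulSum C u = ((∑ i, ‖C i‖ : ℝ) : ℍ[ℝ]) := by
    simp only [rightMulSum, LinearMap.coe_mk, AddHom.coe_mk, hu, mul_smul_comm,
      Quaternion.self_mul_star, Quaternion.normSq_eq_norm_mul_self]
    have hcoe : ((∑ i, ‖C i‖ : ℝ) : ℍ[ℝ]) = ∑ i, ((‖C i‖ : ℝ) : ℍ[ℝ]) :=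
      map_sum (algebraMap ℝ ℍ[ℝ]) (fun i => ‖C i‖) Finset.univ
    rw [hcoe]
    refine Finset.sum_congr rfl fun i _ => ?_
    rw [← Quaternion.coe_smul]
    congr 1
    rcases eq_or_ne ‖C i‖ 0 with h0 | h0
    · simp [h0]
    · simp [h0]
  rw [he, Quaternion.norm_coe] at h
  exact (le_abs_self _).trans h

/-- Order two is the base case, since at order one no bound independent of `r` exists. Two passages
from net to ball give `100/81`; real factors are central, so the vector-valued Grothendieck
inequality applies. -/
theorem norm_quatForm_two_le (hnet : ∀ u : ℍ[ℝ], ‖u‖ ≤ 1 → ∃ v, ‖u - val v‖ ≤ 1 / 10)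
    (A : (Fin 2 → Fin N) → ℍ[ℝ]) {a : ℝ}
    (hA : ∀ v : Fin 2 → Fin N → V, ‖quatPairing A fun j i => val (v j i)‖ ≤ a) {r : ℕ}
    (x : Fin 2 → Fin N → Fin r → ℝ) (ρ : Fin r → ℍ[ℝ]) (hx : ∀ j i, ∑ k, x j i k ^ 2 ≤ 1)
    (hρ : ∀ k, ‖ρ k‖ ≤ 1) : ‖quatForm A x ρ‖ ≤ 32 * (100 / 81) * a := by
  set B : Fin N → Fin N → ℍ[ℝ] := fun i j => A (Fin.cons i (Fin.cons j Fin.elim0)) with hB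
  have hpair : ∀ u : Fin 2 → Fin N → ℍ[ℝ],
      quatPairing A u = ∑ i, ∑ j, B i j * (u 0 i * u 1 j) := fun u => by
    have h0 : ∀ F : (Fin 0 → Fin N) → ℍ[ℝ], ∑ z, F z = F Fin.elim0 := fun F =>
      Fintype.sum_eq_single _ fun x hx => absurd (Subsingleton.elim _ _) hx
    simp only [quatPairing, sum_fin_succ_pi, h0, hB]
    simp [List.ofFn_succ]
  have h1 : ∀ (v : Fin N → V) (t : Fin N → ℍ[ℝ]), (∀ j, ‖t j‖ ≤ 1) →
      ‖∑ i, ∑ j, B i j * (val (v i) * t j)‖ ≤ 10 / 9 * a := by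
    intro v t ht
    have e : ∀ t : Fin N → ℍ[ℝ], ∑ i, ∑ j, B i j * (val (v i) * t j) =
        rightMulSum (fun j => ∑ i, B i j * val (v i)) t := fun t => by
      simp only [rightMulSum, LinearMap.coe_mk, AddHom.coe_mk, Finset.sum_mul, mul_assoc]
      exact Finset.sum_comm
    rw [e]
    refine norm_le_of_net hnet _ (fun v' => ?_) ht
    rw [← e]
    have := hA ![v, v']
    rw [hpair] at this
    simpa using this
  have h2 : ∀ s t : Fin N → ℝ, (∀ i, |s i| ≤ 1) → (∀ j, |t j| ≤ 1) →
      ‖∑ i, ∑ j, (s i * t j) • B i j‖ ≤ 100 / 81 * a := by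
    intro s t hs ht
    have e : ∀ u : Fin N → ℍ[ℝ], ∑ i, ∑ j, B i j * (u i * ((t j : ℝ) : ℍ[ℝ])) =
        rightMulSum (fun i => ∑ j, t j • B i j) u := fun u => by
      simp only [rightMulSum, LinearMap.coe_mk, AddHom.coe_mk, Finset.sum_mul]
      refine Finset.sum_congr rfl fun i _ => Finset.sum_congr rfl fun j _ => ?_
      rw [smul_mul_assoc, ← mul_assoc, Quaternion.mul_coe_eq_smul]
    have h3 := norm_le_of_net hnet (rightMulSum fun i => ∑ j, t j • B i j) (b := 10 / 9 * a)
      (fun v => by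
        rw [← e]
        exact h1 v _ fun j => by rw [Quaternion.norm_coe]; exact ht j)
      (u := fun i => ((s i : ℝ) : ℍ[ℝ])) fun i => by rw [Quaternion.norm_coe]; exact hs i
    refine le_trans (le_of_eq ?_) (h3.trans_eq (by ring))
    congr 1
    rw [← e]
    refine Finset.sum_congr rfl fun i _ => Finset.sum_congr rfl fun j _ => ?_
    rw [← Quaternion.coe_mul, Quaternion.mul_coe_eq_smul]
  -- The four coordinates of `ρ` are absorbed into the second family of vectors, which gives `32 = 4
  -- · 8`.
  have h3 : quatForm A x ρ = ∑ c, quatBasis c *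
      gramForm B (x 0) (fun j k => x 1 j k * quatCoord (ρ k) c) := by
    have h0 : ∀ F : (Fin 0 → Fin N) → ℍ[ℝ], ∑ z, F z = F Fin.elim0 := fun F =>
      Fintype.sum_eq_single _ fun x hx => absurd (Subsingleton.elim _ _) hx
    simp only [quatForm, gramForm, sum_fin_succ_pi, h0, Fin.prod_univ_two, Finset.mul_sum,
      Finset.sum_smul]
    conv_rhs => rw [Finset.sum_comm]
    refine Finset.sum_congr rfl fun i _ => ?_
    conv_rhs => rw [Finset.sum_comm]
    refine Finset.sum_congr rfl fun j _ => ?_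
    conv_rhs => rw [Finset.sum_comm]
    refine Finset.sum_congr rfl fun k _ => ?_
    conv_lhs => rw [← sum_quatCoord_smul (ρ k)]
    rw [Finset.sum_mul, Finset.smul_sum]
    refine Finset.sum_congr rfl fun c _ => ?_
    simp only [Fin.cons_zero, smul_mul_assoc, mul_smul_comm, smul_smul, hB]
    congr 1
    simp [mul_assoc]
  rw [h3]
  calc _ ≤ ∑ c : Fin 4, 8 * (100 / 81 * a) := by
        refine (norm_sum_le _ _).trans (Finset.sum_le_sum fun c _ => ?_)
        rw [norm_mul, norm_quatBasis, one_mul]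
        refine norm_gramForm_le h2 (hx 0) fun j => ?_
        refine le_trans (Finset.sum_le_sum fun k _ => ?_) (hx 1 j)
        rw [mul_pow]
        exact mul_le_of_le_one_right (sq_nonneg _)
          ((sq_le_one_iff_abs_le_one _).2 ((abs_quatCoord_le _ _).trans (hρ k)))
    _ = 32 * (100 / 81) * a := by simp; ring

/-- Multilinear Grothendieck inequality: the growth rate in the order is below `√2`. -/
theorem norm_quatForm_le (hnet : ∀ u : ℍ[ℝ], ‖u‖ ≤ 1 → ∃ v, ‖u - val v‖ ≤ 1 / 10) {d : ℕ}
    (A : (Fin (d + 2) → Fin N) → ℍ[ℝ]) {a : ℝ}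
    (hA : ∀ v : Fin (d + 2) → Fin N → V, ‖quatPairing A fun j i => val (v j i)‖ ≤ a) {r : ℕ}
    (x : Fin (d + 2) → Fin N → Fin r → ℝ) (ρ : Fin r → ℍ[ℝ]) (hx : ∀ j i, ∑ k, x j i k ^ 2 ≤ 1)
    (hρ : ∀ k, ‖ρ k‖ ≤ 1) :
    ‖quatForm A x ρ‖ ≤ 32 * (100 / 81) * (√(3 / 2) * (10 / 9)) ^ d * a := by
  induction d generalizing ρ with
  | zero => simpa using norm_quatForm_two_le hnet A hA x ρ hx hρ
  | succ d ih =>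
    set c := 32 * (100 / 81) * (√(3 / 2) * (10 / 9)) ^ d with hc
    set x' : Fin (d + 2) → Fin N → Fin r → ℝ := fun j => x j.succ with hx'
    set B : Fin N → Fin r → ℍ[ℝ] := fun i k =>
      ∑ ω : Fin (d + 2) → Fin N, (∏ j, x' j (ω j) k) • (ρ k * A (Fin.cons i ω)) with hB
    have hform : quatForm A x ρ = ∑ i, ∑ k, x 0 i k • B i k := by
      simp only [quatForm, sum_fin_succ_pi (m := d + 2), hB]
      refine Finset.sum_congr rfl fun i _ => ?_
      rw [Finset.sum_comm]
      refine Finset.sum_congr rfl fun k _ => ?_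
      rw [Finset.smul_sum]
      refine Finset.sum_congr rfl fun ω _ => ?_
      rw [smul_smul, Fin.prod_univ_succ]
      simp [hx']
    -- For fixed units the inner sums are forms of lower order with multipliers `quatUnit (z k) * ρ
    -- k`, still of norm at most one. This is why the induction carries a general `ρ`.
    have hsum : ∀ z : Fin r → Fin 4 × Bool,
        ∑ i, ‖∑ k, quatUnit (z k) * B i k‖ ≤ 10 / 9 * (c * a) := by
      intro z
      have hC : ∀ i, ∑ k, quatUnit (z k) * B i k =
          quatForm (fun ω => A (Fin.cons i ω)) x' (fun k => quatUnit (z k) * ρ k) := fun i => by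
        simp only [hB, quatForm, Finset.mul_sum, mul_smul_comm, mul_assoc]
        exact Finset.sum_comm
      refine sum_norm_le_of_net hnet _ fun v => ?_
      simp only [hC]
      rw [← quatForm_contractFirst]
      refine ih _ (fun v' => ?_) x' _ (fun j i => hx j.succ i) fun k => ?_
      · rw [quatPairing_contractFirst]
        have := hA (Fin.cons v v')
        convert this using 3
        funext j
        refine Fin.cases ?_ (fun j => ?_) j <;> simp
      · rw [norm_mul, norm_quatUnit, one_mul]; exact hρ k
    rw [hform]
    -- Cauchy–Schwarz in `k` removes the first factor, and Khintchine turns the square functions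
    -- into averages of the sums just bounded.
    calc ‖∑ i, ∑ k, x 0 i k • B i k‖
        ≤ ∑ i, √(∑ k, ‖B i k‖ ^ 2) := by
          refine (norm_sum_le _ _).trans (Finset.sum_le_sum fun i _ => ?_)
          refine (norm_sum_le _ _).trans ?_
          simp only [norm_smul]
          refine (Real.sum_mul_le_sqrt_mul_sqrt _ _ _).trans ?_
          refine mul_le_of_le_one_left (Real.sqrt_nonneg _) ?_
          refine Real.sqrt_le_one.2 ?_
          simpa only [Real.norm_eq_abs, sq_abs] using hx 0 i
      _ ≤ ∑ i, √(3 / 2) * prodExp unitWeight (fun z => ‖∑ k, quatUnit (z k) * B i k‖) :=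
          Finset.sum_le_sum fun i _ => sqrt_sum_norm_sq_le _
      _ = √(3 / 2) * prodExp unitWeight (fun z => ∑ i, ‖∑ k, quatUnit (z k) * B i k‖) := by
          rw [← Finset.mul_sum, prodExp_sum]
      _ ≤ √(3 / 2) * (10 / 9 * (c * a)) := by
          refine mul_le_mul_of_nonneg_left ?_ (Real.sqrt_nonneg _)
          refine (prodExp_mono isWeight_unitWeight hsum).trans_eq ?_
          exact prodExp_const isWeight_unitWeight _
      _ = _ := by rw [hc, pow_succ]; ring

/-- A finite net of the unit ball of the quaternions. -/
theorem exists_quat_net : ∃ (n : ℕ) (val : Fin n → ℍ[ℝ]), (∀ v, ‖val v‖ ≤ 1) ∧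
    ∀ u : ℍ[ℝ], ‖u‖ ≤ 1 → ∃ v, ‖u - val v‖ ≤ 1 / 10 := by
  obtain ⟨t, htb, htf, hcov⟩ :=
    (isCompact_closedBall (0 : ℍ[ℝ]) 1).finite_cover_balls (e := 1 / 10) (by norm_num)
  have := htf.fintype
  set e := (Fintype.equivFin t).symm
  refine ⟨Fintype.card t, fun k => e k, fun v => ?_, fun u hu => ?_⟩
  · simpa using htb (e v).2
  · have h := hcov (show u ∈ Metric.closedBall 0 1 by simpa using hu)
    simp only [Set.mem_iUnion] at h
    obtain ⟨v, hv, huv⟩ := h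
    refine ⟨e.symm ⟨v, hv⟩, ?_⟩
    simp only [Equiv.apply_symm_apply]
    exact (mem_ball_iff_norm.1 huv).le

end QuaternionForm

/-- Allows both norms to be used through every level above `R`, without asking whether the infimum
is attained. -/
theorem le_mul_of_forall_lt {x R M : ℝ} (hM : 0 ≤ M) (h : ∀ c, R < c → x ≤ c * M) :
    x ≤ R * M := by
  refine le_of_forall_pos_le_add fun ε hε => ?_
  have hpos : 0 < ε / (M + 1) := by positivity
  have h1 := h (R + ε / (M + 1)) (by linarith)
  have h2 : ε / (M + 1) * M ≤ ε := by
    rw [div_mul_eq_mul_div, div_le_iff₀ (by positivity)]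
    nlinarith
  linarith

/-! ### Max-qnorm balls: compactness and domination by a finite family. -/

section MaxQNorm

variable {d N : ℕ}

/-- Tensors with a factorization whose factors have rows in the Euclidean unit ball. -/
def unitFactorable (d N : ℕ) : Set (Tensor d N) :=
  {T | ∃ (r : ℕ) (U : Fin d → Matrix (Fin N) (Fin r) ℝ), (∀ j i, ∑ k, U j i k ^ 2 ≤ 1) ∧
    T = outerMat U}

theorem unitFactorable_of_fintype {κ : Type*} [Fintype κ] (U : Fin d → Fin N → κ → ℝ)
    (hU : ∀ j i, ∑ k, U j i k ^ 2 ≤ 1) :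
    (fun ω => ∑ k, ∏ j, U j (ω j) k) ∈ unitFactorable d N := by
  set e := (Fintype.equivFin κ).symm
  refine ⟨Fintype.card κ, fun j => Matrix.of fun i k => U j i (e k), fun j i => ?_, ?_⟩
  · simp only [Matrix.of_apply]
    rw [e.sum_comp fun k => U j i k ^ 2]; exact hU j i
  · funext ω
    simp only [outerMat, Matrix.of_apply]
    exact (e.sum_comp fun k => ∏ j, U j (ω j) k).symm

theorem zero_mem_unitFactorable : (0 : Tensor d N) ∈ unitFactorable d N :=
  ⟨0, fun _ => 0, fun j i => by simp, by funext ω; simp [outerMat]⟩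

/-- Scaling of the first factor. -/
def scaleFirst {r : ℕ} (c : ℝ) (U : Fin (d + 1) → Matrix (Fin N) (Fin r) ℝ) :
    Fin (d + 1) → Matrix (Fin N) (Fin r) ℝ :=
  Fin.cons (c • U 0) fun j => U j.succ

theorem outerMat_scaleFirst {r : ℕ} (c : ℝ) (U : Fin (d + 1) → Matrix (Fin N) (Fin r) ℝ) :
    outerMat (scaleFirst c U) = c • outerMat U := by
  funext ω
  simp [outerMat, scaleFirst, Fin.prod_univ_succ, Finset.mul_sum, mul_assoc]

theorem smul_mem_unitFactorable {c : ℝ} (hc : |c| ≤ 1) {T : Tensor (d + 1) N}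
    (hT : T ∈ unitFactorable (d + 1) N) : c • T ∈ unitFactorable (d + 1) N := by
  obtain ⟨r, U, hU, rfl⟩ := hT
  refine ⟨r, scaleFirst c U, fun j i => ?_, (outerMat_scaleFirst c U).symm⟩
  refine Fin.cases ?_ (fun j => ?_) j
  · refine le_trans (Finset.sum_le_sum fun k _ => ?_) (hU 0 i)
    simp only [scaleFirst, Fin.cons_zero, Matrix.smul_apply, smul_eq_mul, mul_pow]
    exact mul_le_of_le_one_left (sq_nonneg _) ((sq_le_one_iff_abs_le_one c).2 hc)
  · simpa [scaleFirst] using hU j.succ i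

/-- All small tensors are unit factorable. -/
theorem exists_forall_abs_le_mem_unitFactorable (d N : ℕ) :
    ∃ η : ℝ, 0 < η ∧ ∀ T : Tensor (d + 1) N, (∀ ω, |T ω| ≤ η) →
      T ∈ unitFactorable (d + 1) N := by
  set M : ℝ := ((Fintype.card (Fin (d + 1) → Fin N) : ℕ) : ℝ) with hM
  have hM0 : 0 ≤ M := Nat.cast_nonneg _
  set τ : ℝ := 1 / (M + 1) with hτ
  have hτ0 : 0 < τ := by positivity
  have hτM : M * τ ^ 2 ≤ 1 := by
    rw [hτ, div_pow, one_pow, mul_one_div, div_le_one (by positivity)]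
    nlinarith
  refine ⟨τ ^ (d + 1), by positivity, fun T hT => ?_⟩
  set c : Fin (d + 1) → (Fin (d + 1) → Fin N) → ℝ :=
    Fin.cons (fun ω => T ω / τ ^ d) (fun _ _ => τ) with hc
  have hcτ : ∀ j ω, |c j ω| ≤ τ := fun j ω => by
    refine Fin.cases ?_ (fun j => ?_) j
    · simp only [hc, Fin.cons_zero]
      rw [abs_div, abs_of_pos (pow_pos hτ0 d), div_le_iff₀ (by positivity), ← pow_succ']
      exact hT ω
    · simp [hc, abs_of_pos hτ0]
  have h := unitFactorable_of_fintype (d := d + 1) (N := N)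
    -- There is one column per entry `σ`, with indicators as factors; the first factor carries the
    -- entry of `T`. The size `τ` keeps the row norms at most one, as `M τ² ≤ 1`.
    (fun j i (σ : Fin (d + 1) → Fin N) => if i = σ j then c j σ else 0) fun j i => ?_
  · convert h using 1
    funext ω
    rw [Finset.sum_eq_single ω]
    · simp only [if_true, Fin.prod_univ_succ, hc, Fin.cons_zero, Fin.cons_succ, Finset.prod_const,
        Finset.card_univ, Fintype.card_fin]
      field_simp
    · intro σ _ hσ
      obtain ⟨j, hj⟩ := Function.ne_iff.1 hσ
      exact Finset.prod_eq_zero (Finset.mem_univ j) (if_neg fun h => hj h.symm)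
    · simp
  · refine le_trans (Finset.sum_le_sum (g := fun _ => τ ^ 2) fun σ _ => ?_) ?_
    · split_ifs
      · exact sq_le_sq' (abs_le.1 (hcτ j σ)).1 (abs_le.1 (hcτ j σ)).2
      · rw [zero_pow two_ne_zero]; positivity
    · rw [Finset.sum_const, Finset.card_univ, nsmul_eq_mul]
      exact hτM

/-- Concatenation of factorizations. -/
theorem add_mem_unitFactorable {θ : ℝ} (h0 : 0 ≤ θ) (h1 : θ ≤ 1) {T₁ T₂ : Tensor d N}
    (hT₁ : T₁ ∈ unitFactorable d N) (hT₂ : T₂ ∈ unitFactorable d N) :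
    √(1 - θ) ^ d • T₁ + √θ ^ d • T₂ ∈ unitFactorable d N := by
  obtain ⟨r₁, U₁, hU₁, rfl⟩ := hT₁
  obtain ⟨r₂, U₂, hU₂, rfl⟩ := hT₂
  -- Columns are placed side by side; the weights `√(1 - θ)` and `√θ` keep squared row norms at most
  -- `(1 - θ) + θ`.
  have h := unitFactorable_of_fintype (d := d) (N := N) (κ := Fin r₁ ⊕ Fin r₂)
    (fun j i => Sum.elim (fun k => √(1 - θ) * U₁ j i k) (fun k => √θ * U₂ j i k)) fun j i => ?_
  · convert h using 1
    funext ω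
    simp [outerMat, Finset.prod_mul_distrib, Finset.mul_sum]
  · simp only [Fintype.sum_sum_type, Sum.elim_inl, Sum.elim_inr, mul_pow,
      Real.sq_sqrt (sub_nonneg.2 h1), Real.sq_sqrt h0, ← Finset.mul_sum]
    have := mul_le_mul_of_nonneg_left (hU₁ j i) (sub_nonneg.2 h1)
    have := mul_le_mul_of_nonneg_left (hU₂ j i) h0
    linarith

theorem twoInftyNorm_nonneg {r : ℕ} (U : Matrix (Fin N) (Fin r) ℝ) : 0 ≤ twoInftyNorm U :=
  Real.iSup_nonneg fun _ => Real.sqrt_nonneg _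

theorem sum_sq_le_twoInftyNorm_sq {r : ℕ} (U : Matrix (Fin N) (Fin r) ℝ) (i : Fin N) :
    ∑ k, U i k ^ 2 ≤ twoInftyNorm U ^ 2 :=
  (Real.sqrt_le_left (twoInftyNorm_nonneg U)).1
    (le_ciSup (bddAbove_range_of_finite fun i => √(∑ k, U i k ^ 2)) i)

theorem maxQNorm_nonneg (T : Tensor d N) : 0 ≤ maxQNorm T := by
  refine Real.sInf_nonneg ?_
  rintro c ⟨r, U, -, rfl⟩
  exact Finset.prod_nonneg fun j _ => twoInftyNorm_nonneg _

theorem maxQNorm_smul_le {c : ℝ} (hc : 0 ≤ c) {T : Tensor (d + 1) N}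
    (hT : T ∈ unitFactorable (d + 1) N) : maxQNorm (c • T) ≤ c := by
  obtain ⟨r, U, hU, rfl⟩ := hT
  have hU1 : ∀ j, twoInftyNorm (U j) ≤ 1 := fun j =>
    Real.iSup_le (fun i => Real.sqrt_le_one.2 (hU j i)) zero_le_one
  have hle : maxQNorm (c • outerMat U) ≤ ∏ j, twoInftyNorm (scaleFirst c U j) := by
    refine csInf_le ⟨0, ?_⟩ ⟨r, scaleFirst c U, (outerMat_scaleFirst c U).symm, rfl⟩
    rintro c ⟨r, U, -, rfl⟩
    exact Finset.prod_nonneg fun j _ => twoInftyNorm_nonneg _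
  refine hle.trans ?_
  rw [Fin.prod_univ_succ]
  have h1 : twoInftyNorm (scaleFirst c U 0) ≤ c := by
    refine Real.iSup_le (fun i => ?_) hc
    rw [Real.sqrt_le_left hc]
    simp only [scaleFirst, Fin.cons_zero, Matrix.smul_apply, smul_eq_mul, mul_pow,
      ← Finset.mul_sum]
    exact mul_le_of_le_one_right (sq_nonneg c) (hU 0 i)
  have h2 : ∏ j : Fin d, twoInftyNorm (scaleFirst c U j.succ) ≤ 1 :=
    Finset.prod_le_one (fun j _ => twoInftyNorm_nonneg _) fun j _ => by
      simpa [scaleFirst] using hU1 j.succ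
  calc _ ≤ c * 1 := mul_le_mul h1 h2 (Finset.prod_nonneg fun j _ => twoInftyNorm_nonneg _) hc
    _ = c := mul_one c

/-- Ensures that the infimum defining `maxQNorm` is not over the empty set, where `sInf` would be
the default `0`. -/
theorem exists_eq_outerMat (T : Tensor (d + 1) N) :
    ∃ (r : ℕ) (U : Fin (d + 1) → Matrix (Fin N) (Fin r) ℝ), T = outerMat U := by
  obtain ⟨η, hη, h⟩ := exists_forall_abs_le_mem_unitFactorable d N
  have hs : 0 < ‖T‖ / η + 1 := by positivity
  obtain ⟨r, U, -, hU⟩ := h ((‖T‖ / η + 1)⁻¹ • T) fun ω => by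
    rw [Pi.smul_apply, smul_eq_mul, abs_mul, abs_of_pos (inv_pos.2 hs), inv_mul_le_iff₀ hs]
    refine (norm_le_pi_norm T ω).trans ?_
    rw [add_mul, div_mul_cancel₀ _ hη.ne']
    linarith
  refine ⟨r, scaleFirst (‖T‖ / η + 1) U, ?_⟩
  rw [outerMat_scaleFirst, ← hU, smul_inv_smul₀ hs.ne']

/-- Each factor of a near-optimal factorization is divided by its norm; if some factor has norm
zero, then `T = 0`. -/
theorem exists_eq_smul_of_maxQNorm_lt {T : Tensor (d + 1) N} {c : ℝ} (hc : maxQNorm T < c) :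
    ∃ T' ∈ unitFactorable (d + 1) N, T = c • T' := by
  have hc0 : 0 < c := (maxQNorm_nonneg T).trans_lt hc
  obtain ⟨r₀, U₀, hU₀⟩ := exists_eq_outerMat T
  have hne : {c : ℝ | ∃ (r : ℕ) (U : Fin (d + 1) → Matrix (Fin N) (Fin r) ℝ),
      T = outerMat U ∧ c = ∏ j, twoInftyNorm (U j)}.Nonempty := ⟨_, r₀, U₀, hU₀, rfl⟩
  obtain ⟨c₀, ⟨r, U, hU, rfl⟩, hlt⟩ := exists_lt_of_csInf_lt hne hc
  by_cases hz : ∃ j, twoInftyNorm (U j) = 0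
  · obtain ⟨j, hj⟩ := hz
    refine ⟨0, zero_mem_unitFactorable, ?_⟩
    rw [hU, smul_zero]
    funext ω
    refine Finset.sum_eq_zero fun k _ => Finset.prod_eq_zero (Finset.mem_univ j) ?_
    have h1 := sum_sq_le_twoInftyNorm_sq (U j) (ω j)
    rw [hj, zero_pow two_ne_zero] at h1
    have h2 := Finset.single_le_sum (f := fun k => U j (ω j) k ^ 2)
      (fun k _ => sq_nonneg _) (Finset.mem_univ k)
    exact pow_eq_zero_iff two_ne_zero |>.1 (le_antisymm (h2.trans h1) (sq_nonneg _))
  · push Not at hz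
    set n := fun j => twoInftyNorm (U j) with hn
    have hn0 : ∀ j, 0 < n j := fun j => lt_of_le_of_ne (twoInftyNorm_nonneg _) (hz j).symm
    have hP : 0 < ∏ j, n j := Finset.prod_pos fun j _ => hn0 j
    have hmem : outerMat (fun j => (n j)⁻¹ • U j) ∈ unitFactorable (d + 1) N := by
      refine ⟨r, _, fun j i => ?_, rfl⟩
      simp only [Matrix.smul_apply, smul_eq_mul, mul_pow, ← Finset.mul_sum, inv_pow]
      rw [inv_mul_le_iff₀ (pow_pos (hn0 j) 2), mul_one]
      exact sum_sq_le_twoInftyNorm_sq _ _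
    refine ⟨((∏ j, n j) / c) • outerMat (fun j => (n j)⁻¹ • U j),
      smul_mem_unitFactorable ?_ hmem, ?_⟩
    · rw [abs_of_pos (div_pos hP hc0), div_le_one hc0]
      exact hlt.le
    · rw [hU, smul_smul, mul_div_cancel₀ _ hc0.ne']
      funext ω
      simp only [outerMat, Pi.smul_apply, smul_eq_mul, Matrix.smul_apply, Finset.mul_sum,
        Finset.prod_mul_distrib, Finset.prod_inv_distrib]
      refine Finset.sum_congr rfl fun k _ => ?_
      rw [mul_inv_cancel_left₀ hP.ne']

/-- A limit `T` differs from a nearby member by a tiny tensor, which is unit factorable even after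
division by a small number. Appending its columns costs only the factor `√(1 - θ) ^ (d + 1)`, which
tends to one, so no bound on the number of columns is needed. -/
theorem isClosed_maxQNorm_le (R : ℝ) : IsClosed {T : Tensor (d + 1) N | maxQNorm T ≤ R} := by
  refine isClosed_of_closure_subset fun T hT => ?_
  obtain ⟨η, hη, hsmall⟩ := exists_forall_abs_le_mem_unitFactorable d N
  have hR : 0 ≤ R := by
    obtain ⟨X, hX⟩ := closure_nonempty_iff.1 ⟨T, hT⟩
    exact (maxQNorm_nonneg X).trans hX
  change maxQNorm T ≤ R
  refine le_of_forall_gt_imp_ge_of_dense fun c hc => ?_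
  have hc0 : 0 < c := hR.trans_lt hc
  obtain ⟨c₁, hc₁, hc₁c⟩ := exists_between hc
  obtain ⟨θ, hθ0, hθ1, hθ⟩ : ∃ θ : ℝ, 0 < θ ∧ θ < 1 ∧ c₁ < c * √(1 - θ) ^ (d + 1) := by
    have hcont : Filter.Tendsto (fun θ : ℝ => c * √(1 - θ) ^ (d + 1))
        (nhdsWithin 0 (Set.Ioi 0)) (nhds (c * √(1 - 0) ^ (d + 1))) :=
      (Continuous.tendsto (by fun_prop) 0).mono_left nhdsWithin_le_nhds
    rw [sub_zero, Real.sqrt_one, one_pow, mul_one] at hcont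
    have h1 := hcont.eventually (lt_mem_nhds hc₁c)
    have h2 : ∀ᶠ θ : ℝ in nhdsWithin 0 (Set.Ioi 0), θ ∈ Set.Ioo (0 : ℝ) 1 :=
      Ioo_mem_nhdsGT zero_lt_one
    obtain ⟨θ, h3, h4⟩ := (h1.and h2).exists
    exact ⟨θ, h4.1, h4.2, h3⟩
  set q := √(1 - θ) ^ (d + 1) with hq
  set s := √θ ^ (d + 1) with hs
  have hq0 : 0 < q := pow_pos (Real.sqrt_pos.2 (by linarith)) _
  have hs0 : 0 < s := pow_pos (Real.sqrt_pos.2 hθ0) _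
  obtain ⟨X, hX, hTX⟩ := Metric.mem_closure_iff.1 hT (c * s * η) (by positivity)
  obtain ⟨X', hX', rfl⟩ := exists_eq_smul_of_maxQNorm_lt (lt_of_le_of_lt hX hc₁)
  have hE : (c * s)⁻¹ • (T - c₁ • X') ∈ unitFactorable (d + 1) N := hsmall _ fun ω => by
    rw [Pi.smul_apply, smul_eq_mul, abs_mul, abs_of_pos (by positivity),
      inv_mul_le_iff₀ (by positivity)]
    rw [dist_eq_norm] at hTX
    exact (norm_le_pi_norm (T - c₁ • X') ω).trans hTX.le
  have hY : (c₁ / (c * q)) • X' ∈ unitFactorable (d + 1) N := by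
    refine smul_mem_unitFactorable ?_ hX'
    rw [abs_of_nonneg (div_nonneg (hR.trans hc₁.le) (by positivity)), div_le_one (by positivity)]
    exact hθ.le
  have hmem := add_mem_unitFactorable hθ0.le hθ1.le hY hE
  have hT' : T = c • (q • (c₁ / (c * q)) • X' + s • (c * s)⁻¹ • (T - c₁ • X')) := by
    funext ω
    simp only [Pi.smul_apply, Pi.add_apply, Pi.sub_apply, smul_eq_mul]
    field_simp
    ring
  rw [hT']
  exact maxQNorm_smul_le hc0.le hmem

theorem isCompact_abs_le {α : ℝ} {C : Set (Tensor d N)} (hC : IsClosed C) :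
    IsCompact {T : Tensor d N | (∀ ω, |T ω| ≤ α) ∧ T ∈ C} := by
  have h : {T : Tensor d N | (∀ ω, |T ω| ≤ α) ∧ T ∈ C} =
      (Set.univ.pi fun _ => Set.Icc (-α) α) ∩ C := by
    ext T
    simp only [Set.mem_ofPred_eq, Set.mem_inter_iff, Set.mem_pi, Set.mem_univ, true_imp_iff,
      Set.mem_Icc, abs_le]
  rw [h]
  exact (isCompact_univ_pi fun _ => isCompact_Icc).inter_right hC

theorem isCompact_KMax (α R : ℝ) : IsCompact (KMax (d + 1) N α R) :=
  isCompact_abs_le (isClosed_maxQNorm_le R)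

open scoped Quaternion

/-- The real coordinates, up to sign, of the rank-one quaternion tensors with factors in a finite
family. -/
noncomputable def quatFamily {n : ℕ} (val : Fin n → ℍ[ℝ]) (j : (Fin d → Fin N → Fin n) × Fin 4 × Bool) :
    Tensor d N :=
  fun ω => boolSign j.2.2 * quatCoord (List.ofFn fun s => val (j.1 s (ω s))).prod j.2.1

theorem abs_boolSign (b : Bool) : |boolSign b| = 1 := by
  cases b <;> simp [boolSign]

theorem abs_quatFamily_le {n : ℕ} {val : Fin n → ℍ[ℝ]} (hval : ∀ v, ‖val v‖ ≤ 1)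
    (j : (Fin d → Fin N → Fin n) × Fin 4 × Bool) (ω : Fin d → Fin N) :
    |quatFamily val j ω| ≤ 1 := by
  rw [quatFamily, abs_mul, abs_boolSign, one_mul]
  refine (abs_quatCoord_le _ _).trans ?_
  rw [List.norm_prod, List.map_ofFn, List.prod_ofFn]
  exact Finset.prod_le_one (fun _ _ => norm_nonneg _) fun _ _ => hval _

theorem quatCoord_coe_mul (x : ℝ) (q : ℍ[ℝ]) (c : Fin 4) :
    quatCoord ((x : ℍ[ℝ]) * q) c = x * quatCoord q c := by
  fin_cases c <;> simp [quatCoord]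

theorem quatCoord_sum {ι : Type*} (s : Finset ι) (q : ι → ℍ[ℝ]) (c : Fin 4) :
    quatCoord (∑ i ∈ s, q i) c = ∑ i ∈ s, quatCoord (q i) c := by
  have h0 : quatCoord 0 c = 0 := by fin_cases c <;> simp [quatCoord]
  have hadd : ∀ p q : ℍ[ℝ], quatCoord (p + q) c = quatCoord p c + quatCoord q c := fun p q => by
    fin_cases c <;> simp [quatCoord]
  exact map_sum (⟨⟨fun q => quatCoord q c, h0⟩, hadd⟩ : ℍ[ℝ] →+ ℝ) q s

/-- The max-qnorm ball is dominated by a finite family of rank-one quaternion tensors. -/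
theorem sum_mul_le_of_maxQNorm_le {n : ℕ} {val : Fin n → ℍ[ℝ]}
    (hnet : ∀ u : ℍ[ℝ], ‖u‖ ≤ 1 → ∃ v, ‖u - val v‖ ≤ 1 / 10) {X : Tensor (d + 2) N} {R : ℝ}
    (hX : maxQNorm X ≤ R) (A : Tensor (d + 2) N) {a : ℝ}
    (hA : ∀ j, ∑ ω, A ω * quatFamily val j ω ≤ a) :
    ∑ ω, A ω * X ω ≤ 128 * (100 / 81) * (√(3 / 2) * (10 / 9)) ^ d * R * a := by
  set A' : (Fin (d + 2) → Fin N) → ℍ[ℝ] := fun ω => (A ω : ℍ[ℝ]) with hA'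
  have hcoord : ∀ (v : Fin (d + 2) → Fin N → Fin n) (c : Fin 4),
      |quatCoord (quatPairing A' fun j i => val (v j i)) c| ≤ a := fun v c => by
    have h1 := hA (v, c, true)
    have h2 := hA (v, c, false)
    simp only [quatFamily, boolSign, if_true, Bool.false_eq_true, if_false, one_mul, neg_mul,
      mul_neg, Finset.sum_neg_distrib] at h1 h2
    simp only [quatPairing, quatCoord_sum, hA', quatCoord_coe_mul]
    exact abs_le.2 ⟨by linarith, h1⟩
  -- Four coordinates, each at most `a` in modulus, turn the constant `32` into `128`.
  have hpair : ∀ v : Fin (d + 2) → Fin N → Fin n,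
      ‖quatPairing A' fun j i => val (v j i)‖ ≤ 4 * a := fun v => by
    refine (norm_le_sum_quatCoord _).trans
      ((Finset.sum_le_sum fun c _ => hcoord v c).trans_eq ?_)
    simp
  obtain ⟨v₀, -⟩ := hnet 0 (by simp)
  have ha : 0 ≤ a := (abs_nonneg _).trans (hcoord (fun _ _ => v₀) 0)
  set κ := √(3 / 2) * (10 / 9) with hκ
  have hκ0 : 0 ≤ κ := by positivity
  have hunit : ∀ Y ∈ unitFactorable (d + 2) N,
      ∑ ω, A ω * Y ω ≤ 128 * (100 / 81) * κ ^ d * a := by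
    rintro Y ⟨r, U, hU, rfl⟩
    -- With real coefficients and `ρ = 1` the form is the real pairing of `A` with the factored
    -- tensor.
    have h := norm_quatForm_le hnet A' hpair (fun j => U j) (fun _ => 1) hU (by simp)
    have he : quatForm A' (fun j => U j) (fun _ : Fin r => 1) =
        ((∑ ω, A ω * outerMat U ω : ℝ) : ℍ[ℝ]) := by
      have hcoe : ((∑ ω, A ω * outerMat U ω : ℝ) : ℍ[ℝ]) =
          ∑ ω, ((A ω * outerMat U ω : ℝ) : ℍ[ℝ]) :=
        map_sum (algebraMap ℝ ℍ[ℝ]) (fun ω => A ω * outerMat U ω) Finset.univ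
      rw [hcoe]
      refine Finset.sum_congr rfl fun ω _ => ?_
      rw [← Finset.sum_smul, one_mul, mul_comm, Quaternion.coe_mul, Quaternion.coe_mul_eq_smul]
      rfl
    rw [he, Quaternion.norm_coe] at h
    refine ((le_abs_self _).trans h).trans_eq ?_
    ring
  have hfin := le_mul_of_forall_lt (x := ∑ ω, A ω * X ω) (R := R)
    (M := 128 * (100 / 81) * κ ^ d * a) (by positivity) fun c hc => by
      obtain ⟨Y, hY, hXY⟩ := exists_eq_smul_of_maxQNorm_lt (hX.trans_lt hc)
      have hc0 : 0 < c := ((maxQNorm_nonneg X).trans hX).trans_lt hc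
      rw [hXY]
      simp only [Pi.smul_apply, smul_eq_mul]
      have := mul_le_mul_of_nonneg_left (hunit Y hY) hc0.le
      rw [Finset.mul_sum] at this
      refine le_trans (le_of_eq (Finset.sum_congr rfl fun _ _ => by ring)) this
  linarith

end MaxQNorm

/-! ### M-norm balls and rank-one sign tensors. -/

section MNorm

variable {d N : ℕ}

/-- A vector of signs. -/
def IsSignVec (s : Fin N → ℝ) : Prop := ∀ i, s i = 1 ∨ s i = -1

theorem outerVec_eq_one_or {s : Fin d → Fin N → ℝ} (hs : ∀ j, IsSignVec (s j))
    (ω : Fin d → Fin N) : outerVec s ω = 1 ∨ outerVec s ω = -1 := by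
  have h : |outerVec s ω| = 1 := by
    rw [outerVec, Finset.abs_prod]
    exact Finset.prod_eq_one fun j _ => by rcases hs j (ω j) with h | h <;> simp [h]
  exact eq_or_eq_neg_of_abs_eq h

theorem outerVec_mem_signTensors (hN : 0 < N) {s : Fin d → Fin N → ℝ}
    (hs : ∀ j, IsSignVec (s j)) : outerVec s ∈ signTensors d N := by
  refine ⟨outerVec_eq_one_or hs, ?_⟩
  have hN' : (0 : ℝ) < N := Nat.cast_pos.2 hN
  have hsq : 0 < √(N : ℝ) := Real.sqrt_pos.2 hN'
  have h1 : 1 ∈ {r : ℕ | ∃ S : Fin r → Tensor d N, (∀ i, IsRankOneTensor (S i)) ∧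
      outerVec s = ∑ i, S i} := by
    refine ⟨fun _ => outerVec s, fun _ => ⟨√(N : ℝ) ^ d, outerVec fun j i => s j i / √(N : ℝ),
      (pow_pos hsq d).ne', ⟨_, fun j => ?_, rfl⟩, ?_⟩, by simp⟩
    · have : ∀ i, (s j i / √(N : ℝ)) ^ 2 = 1 / N := fun i => by
        rw [div_pow, Real.sq_sqrt hN'.le]
        rcases hs j i with h | h <;> simp [h]
      simp [this, hN'.ne']
    · funext ω
      simp only [outerVec, Pi.smul_apply, smul_eq_mul, Finset.prod_div_distrib, Finset.prod_const,
        Finset.card_univ, Fintype.card_fin]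
      field_simp
  refine le_antisymm (Nat.sInf_le h1) (Nat.one_le_iff_ne_zero.2 fun h0 => ?_)
  have hmem := Nat.sInf_mem ⟨1, h1⟩
  rw [tensorRank] at h0
  rw [h0] at hmem
  obtain ⟨S, -, hS⟩ := hmem
  have := congrFun hS fun _ => ⟨0, hN⟩
  rw [Finset.univ_eq_empty, Finset.sum_empty, Pi.zero_apply] at this
  rcases outerVec_eq_one_or hs fun _ => ⟨0, hN⟩ with h | h <;> rw [h] at this <;> norm_num at this

/-- The rank-one sign tensors, indexed by booleans. -/
def signFamily (j : Bool × (Fin d → Fin N → Bool)) : Tensor d N :=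
  fun ω => boolSign j.1 * ∏ s, boolSign (j.2 s (ω s))

theorem abs_signFamily_le (j : Bool × (Fin d → Fin N → Bool)) (ω : Fin d → Fin N) :
    |signFamily j ω| ≤ 1 := by
  rw [signFamily, abs_mul, Finset.abs_prod]
  simp [abs_boolSign]

theorem exists_boolSign_mul_abs (x : ℝ) : ∃ b, x = boolSign b * |x| := by
  rcases abs_choice x with h | h
  · exact ⟨true, by simp [boolSign, h]⟩
  · exact ⟨false, by simp [boolSign, h]⟩

/-- All entries have modulus one, so the moduli of the scalar and of the factors multiply to one and
only their signs matter. -/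
theorem exists_eq_signFamily {X : Tensor d N} (hX : X ∈ signTensors d N) :
    ∃ j, X = signFamily j := by
  obtain ⟨hsign, hrank⟩ := hX
  -- Rank one excludes the empty set, for which `sInf` is `0`.
  have hne : {r : ℕ | ∃ S : Fin r → Tensor d N, (∀ i, IsRankOneTensor (S i)) ∧
      X = ∑ i, S i}.Nonempty := by
    by_contra h
    rw [Set.not_nonempty_iff_eq_empty] at h
    rw [tensorRank, h, Nat.sInf_empty] at hrank
    exact zero_ne_one hrank
  have hmem := Nat.sInf_mem hne
  rw [tensorRank] at hrank
  rw [hrank] at hmem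
  obtain ⟨S, hS, hXS⟩ := hmem
  obtain ⟨c, _, -, ⟨u, -, rfl⟩, hSu⟩ := hS 0
  rw [Fin.sum_univ_one, hSu] at hXS
  obtain ⟨e, he⟩ := exists_boolSign_mul_abs c
  choose b hb using fun j i => exists_boolSign_mul_abs (u j i)
  refine ⟨(e, b), ?_⟩
  funext ω
  have h1 : X ω = c * ∏ j, u j (ω j) := by rw [hXS]; rfl
  have h2 : |c| * ∏ j, |u j (ω j)| = 1 := by
    rw [← Finset.abs_prod, ← abs_mul, ← h1]
    rcases hsign ω with h | h <;> simp [h]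
  have h3 : ∏ j, u j (ω j) = (∏ j, boolSign (b j (ω j))) * ∏ j, |u j (ω j)| := by
    rw [← Finset.prod_mul_distrib]
    exact Finset.prod_congr rfl fun j _ => hb j (ω j)
  calc X ω = (boolSign e * ∏ j, boolSign (b j (ω j))) * (|c| * ∏ j, |u j (ω j)|) := by
        rw [h1, h3]
        conv_lhs => rw [he]
        ring
    _ = _ := by rw [h2, mul_one]; rfl

theorem isSignVec_boolSign (b : Fin N → Bool) : IsSignVec fun i => boolSign (b i) := fun i => by
  rcases h : b i <;> simp [boolSign, h]

theorem signFamily_mem_signTensors (hN : 0 < N) (j : Bool × (Fin (d + 1) → Fin N → Bool)) :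
    signFamily j ∈ signTensors (d + 1) N := by
  have h : signFamily j = outerVec (Fin.cons (fun i => boolSign j.1 * boolSign (j.2 0 i))
      (fun s i => boolSign (j.2 s.succ i)) : Fin (d + 1) → Fin N → ℝ) := by
    funext ω
    simp [signFamily, outerVec, Fin.prod_univ_succ, mul_assoc]
  rw [h]
  refine outerVec_mem_signTensors hN fun s => ?_
  refine Fin.cases ?_ (fun s => ?_) s
  · intro i
    rw [Fin.cons_zero]
    cases j.1 <;> cases j.2 0 i <;> simp [boolSign]
  · rw [Fin.cons_succ]
    exact isSignVec_boolSign _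

theorem finite_signTensors (d N : ℕ) : (signTensors d N).Finite :=
  (Set.finite_range (signFamily (d := d) (N := N))).subset fun X hX => by
    obtain ⟨j, hj⟩ := exists_eq_signFamily hX
    exact ⟨j, hj.symm⟩

theorem neg_mem_convexHull_signTensors (hN : 0 < N) {X : Tensor (d + 1) N}
    (hX : X ∈ convexHull ℝ (signTensors (d + 1) N)) :
    -X ∈ convexHull ℝ (signTensors (d + 1) N) := by
  have hneg : -signTensors (d + 1) N ⊆ signTensors (d + 1) N := fun Y hY => by
    obtain ⟨⟨e, b⟩, hj⟩ := exists_eq_signFamily hY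
    have : Y = signFamily (!e, b) := by
      rw [← neg_neg Y, hj]
      funext ω
      cases e <;> simp [signFamily, boolSign]
    rw [this]
    exact signFamily_mem_signTensors hN _
  refine convexHull_mono hneg ?_
  rw [convexHull_neg]
  simpa using hX

theorem zero_mem_convexHull_signTensors (hN : 0 < N) :
    (0 : Tensor (d + 1) N) ∈ convexHull ℝ (signTensors (d + 1) N) := by
  have h := subset_convexHull ℝ _ (signFamily_mem_signTensors (d := d) hN (true, fun _ _ => true))
  have h2 := (convex_convexHull ℝ _) h (neg_mem_convexHull_signTensors hN h)
    (a := 1 / 2) (b := 1 / 2) (by norm_num) (by norm_num) (by norm_num)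
  simpa using h2

theorem smul_mem_convexHull_signTensors (hN : 0 < N) {X : Tensor (d + 1) N}
    (hX : X ∈ convexHull ℝ (signTensors (d + 1) N)) {c : ℝ} (hc : |c| ≤ 1) :
    c • X ∈ convexHull ℝ (signTensors (d + 1) N) := by
  have hpos : ∀ c : ℝ, 0 ≤ c → c ≤ 1 → c • X ∈ convexHull ℝ (signTensors (d + 1) N) :=
    fun c h0 h1 => (convex_convexHull ℝ _).smul_mem_of_zero_mem
      (zero_mem_convexHull_signTensors hN) hX ⟨h0, h1⟩
  rcases le_total 0 c with h | h
  · exact hpos c h ((le_abs_self c).trans hc)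
  · have := neg_mem_convexHull_signTensors hN
      (hpos (-c) (neg_nonneg.2 h) ((neg_le_abs c).trans hc))
    simpa using this

/-- In each variable the indicator of a point is the mean of the constant `1` and a sign vector.
Expanding the product gives a convex combination of `2 ^ (d + 1)` sign tensors. -/
theorem single_mem_convexHull_signTensors (hN : 0 < N) (σ : Fin (d + 1) → Fin N) :
    (Pi.single σ 1 : Tensor (d + 1) N) ∈ convexHull ℝ (signTensors (d + 1) N) := by
  set y : Fin (d + 1) → Bool → Fin N → ℝ :=
    fun j b i => if b then 1 else if i = σ j then 1 else -1 with hy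
  have hexp : (Pi.single σ 1 : Tensor (d + 1) N) =
      ∑ b : Fin (d + 1) → Bool, (1 / 2 : ℝ) ^ (d + 1) • outerVec fun j => y j (b j) := by
    funext ω
    rw [Finset.sum_apply]
    simp only [Pi.smul_apply, smul_eq_mul, outerVec]
    have h1 := Finset.prod_univ_sum (fun _ : Fin (d + 1) => (Finset.univ : Finset Bool))
      fun j b => 1 / 2 * y j b (ω j)
    simp only [Fintype.piFinset_univ, Finset.prod_mul_distrib, Finset.prod_const,
      Finset.card_univ, Fintype.card_fin] at h1
    rw [← h1]
    have h2 : ∀ j, ∑ b, 1 / 2 * y j b (ω j) = if ω j = σ j then 1 else 0 := fun j => by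
      simp only [Fintype.sum_bool, hy, if_true, Bool.false_eq_true, if_false]
      split_ifs <;> norm_num
    simp only [h2]
    by_cases h : ω = σ
    · subst h; simp
    · rw [Pi.single_eq_of_ne h]
      obtain ⟨j, hj⟩ := Function.ne_iff.1 h
      exact (Finset.prod_eq_zero (Finset.mem_univ j) (if_neg hj)).symm
  rw [hexp]
  refine (convex_convexHull ℝ _).sum_mem (fun _ _ => by positivity) ?_ fun b _ => ?_
  · simp
  · refine subset_convexHull ℝ _ (outerVec_mem_signTensors hN fun j i => ?_)
    simp only [hy]
    split_ifs <;> simp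

/-- The hull is absorbing, so the infimum defining `mNorm` is over a nonempty set. -/
theorem exists_mem_smul_convexHull (hN : 0 < N) (T : Tensor (d + 1) N) :
    ∃ t : ℝ, 0 < t ∧ T ∈ t • convexHull ℝ (signTensors (d + 1) N) := by
  have hT : T = ∑ σ, T σ • (Pi.single σ 1 : Tensor (d + 1) N) := by
    funext ω
    simp [Finset.sum_apply, Pi.single_apply]
  rw [hT]
  refine Finset.sum_induction _ (fun X => ∃ t : ℝ, 0 < t ∧
    X ∈ t • convexHull ℝ (signTensors (d + 1) N)) ?_ ?_ fun σ _ => ?_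
  · rintro X Y ⟨s, hs, hX⟩ ⟨t, ht, hY⟩
    refine ⟨s + t, by positivity, ?_⟩
    rw [(convex_convexHull ℝ _).add_smul hs.le ht.le]
    exact Set.add_mem_add hX hY
  · exact ⟨1, one_pos, by rw [one_smul]; exact zero_mem_convexHull_signTensors hN⟩
  · have hpos : 0 < |T σ| + 1 := by positivity
    refine ⟨|T σ| + 1, hpos, Set.mem_smul_set.2 ⟨(T σ / (|T σ| + 1)) • Pi.single σ 1,
      smul_mem_convexHull_signTensors hN (single_mem_convexHull_signTensors hN σ) ?_, ?_⟩⟩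
    · rw [abs_div, abs_of_pos hpos, div_le_one hpos]; linarith
    · rw [smul_smul, mul_div_cancel₀ _ hpos.ne']

theorem mNorm_nonneg (T : Tensor d N) : 0 ≤ mNorm T :=
  Real.sInf_nonneg fun _ ht => ht.1.le

theorem mNorm_le {T : Tensor d N} {c : ℝ} (hc : 0 < c)
    (hT : T ∈ c • convexHull ℝ (signTensors d N)) : mNorm T ≤ c :=
  csInf_le ⟨0, fun _ ht => ht.1.le⟩ ⟨hc, hT⟩

theorem mem_smul_of_mNorm_lt (hN : 0 < N) {T : Tensor (d + 1) N} {c : ℝ} (hc : mNorm T < c) :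
    T ∈ c • convexHull ℝ (signTensors (d + 1) N) := by
  obtain ⟨t, ⟨ht0, hT⟩, htc⟩ := exists_lt_of_csInf_lt (exists_mem_smul_convexHull hN T) hc
  have hc0 : 0 < c := ht0.trans htc
  obtain ⟨X, hX, rfl⟩ := Set.mem_smul_set.1 hT
  refine Set.mem_smul_set.2 ⟨(t / c) • X, smul_mem_convexHull_signTensors hN hX ?_, ?_⟩
  · rw [abs_of_pos (div_pos ht0 hc0), div_le_one hc0]
    exact htc.le
  · rw [smul_smul, mul_div_cancel₀ _ hc0.ne']

/-- There are finitely many sign tensors, so multiples of their hull are compact; closures are taken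
at each level `c > R`. -/
theorem isClosed_mNorm_le (hN : 0 < N) (R : ℝ) :
    IsClosed {T : Tensor (d + 1) N | mNorm T ≤ R} := by
  refine isClosed_of_closure_subset fun T hT => ?_
  have hR : 0 ≤ R := by
    obtain ⟨X, hX⟩ := closure_nonempty_iff.1 ⟨T, hT⟩
    exact (mNorm_nonneg X).trans hX
  change mNorm T ≤ R
  refine le_of_forall_gt_imp_ge_of_dense fun c hc => mNorm_le (hR.trans_lt hc) ?_
  have hcl : IsClosed (c • convexHull ℝ (signTensors (d + 1) N)) :=
    (((finite_signTensors (d + 1) N).isCompact_convexHull (𝕜 := ℝ)).smul c).isClosed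
  exact closure_minimal (fun X hX => mem_smul_of_mNorm_lt hN (lt_of_le_of_lt hX hc)) hcl hT

theorem isCompact_KM (hN : 0 < N) (α R : ℝ) : IsCompact (KM (d + 1) N α R) :=
  isCompact_abs_le (isClosed_mNorm_le hN R)

/-- The M-norm ball is dominated by the rank-one sign tensors. -/
theorem sum_mul_le_of_mNorm_le (hN : 0 < N) {X : Tensor (d + 1) N} {R : ℝ} (hX : mNorm X ≤ R)
    (A : Tensor (d + 1) N) {a : ℝ} (hA : ∀ j, ∑ ω, A ω * signFamily j ω ≤ a) :
    ∑ ω, A ω * X ω ≤ R * a := by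
  have ha : 0 ≤ a := by
    have h1 := hA (true, fun _ _ => true)
    have h2 := hA (false, fun _ _ => true)
    simp [signFamily, boolSign] at h1 h2
    linarith
  have hhull : ∀ Y ∈ convexHull ℝ (signTensors (d + 1) N), ∑ ω, A ω * Y ω ≤ a := by
    intro Y hY
    have hlin : IsLinearMap ℝ fun Y : Tensor (d + 1) N => ∑ ω, A ω * Y ω :=
      ⟨fun Y Z => by simp [mul_add, Finset.sum_add_distrib],
        fun c Y => by simp [Finset.mul_sum, mul_left_comm]⟩
    refine convexHull_min (fun Z hZ => ?_) (convex_halfSpace_le hlin a) hY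
    obtain ⟨j, rfl⟩ := exists_eq_signFamily hZ
    exact hA j
  refine le_mul_of_forall_lt ha fun c hc => ?_
  have hc0 : 0 < c := ((mNorm_nonneg X).trans hX).trans_lt hc
  obtain ⟨Y, hY, rfl⟩ := Set.mem_smul_set.1 (mem_smul_of_mNorm_lt hN (hX.trans_lt hc))
  refine le_trans (le_of_eq ?_) (mul_le_mul_of_nonneg_left (hhull Y hY) hc0.le)
  rw [Finset.mul_sum]
  exact Finset.sum_congr rfl fun _ _ => by simp only [Pi.smul_apply, smul_eq_mul]; ring

end MNorm

/-! ### Log-cardinalities of order `dN`, the source of the rate `√(dN/m)`. -/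

theorem card_signFamily_le {d N : ℕ} (hdN : 0 < d * N) :
    (Fintype.card (Bool × (Fin d → Fin N → Bool)) : ℝ) ≤ Real.exp (2 * (d * N)) := by
  have hcard : (Fintype.card (Bool × (Fin d → Fin N → Bool)) : ℝ) = 2 * 2 ^ (d * N) := by
    simp [Fintype.card_prod, Fintype.card_bool, ← pow_mul, mul_comm N d]
  have h2 : (2 : ℝ) ≤ Real.exp 1 := by have := Real.add_one_le_exp (1 : ℝ); linarith
  rw [hcard, ← pow_succ']
  calc (2 : ℝ) ^ (d * N + 1) ≤ 2 ^ (2 * (d * N)) :=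
        pow_le_pow_right₀ one_le_two (by omega)
    _ ≤ Real.exp 1 ^ (2 * (d * N)) := pow_le_pow_left₀ zero_le_two h2 _
    _ = Real.exp (2 * (d * N)) := by
        rw [← Real.exp_nat_mul]; push_cast; rw [mul_one]

theorem card_quatFamily_le {d N n : ℕ} (hdN : 0 < d * N) :
    (Fintype.card ((Fin d → Fin N → Fin n) × Fin 4 × Bool) : ℝ) ≤
      Real.exp (8 * (n + 1) * (d * N)) := by
  have hcard : (Fintype.card ((Fin d → Fin N → Fin n) × Fin 4 × Bool) : ℝ) =
      n ^ (d * N) * 8 := by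
    simp [Fintype.card_prod, Fintype.card_bool, ← pow_mul, mul_comm N d]
  have hn : (n : ℝ) ≤ Real.exp n := by have := Real.add_one_le_exp (n : ℝ); linarith
  have h8 : (8 : ℝ) ≤ Real.exp 8 := by have := Real.add_one_le_exp (8 : ℝ); linarith
  have hdN' : (1 : ℝ) ≤ d * N := by exact_mod_cast hdN
  have hn0 : (0 : ℝ) ≤ n := Nat.cast_nonneg n
  rw [hcard]
  calc (n : ℝ) ^ (d * N) * 8 ≤ Real.exp n ^ (d * N) * Real.exp 8 :=
        mul_le_mul (pow_le_pow_left₀ hn0 hn _) h8 (by norm_num) (by positivity)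
    _ = Real.exp (d * N * n + 8) := by rw [← Real.exp_nat_mul, ← Real.exp_add]; push_cast; rfl
    _ ≤ Real.exp (8 * (n + 1) * (d * N)) := Real.exp_le_exp.2 (by nlinarith)

end OneBit

/-! ### Choice of constants and conclusion. -/

theorem mainTheorem1 :
    ∃ Cmax CM c₂ : ℝ, 0 < Cmax ∧ 0 < CM ∧ 0 < c₂ ∧ c₂ < Real.sqrt 2 ∧
      ∀ (d N m : ℕ), 2 ≤ m → m ≤ N ^ d →
      ∀ (f : ℝ → ℝ) (α : ℝ), OneBit.IsLink f α →
      ∀ (T : OneBit.Tensor d N), (∀ ω, |T ω| ≤ α) →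
      ∀ (p : (Fin d → Fin N) → ℝ), (∀ ω, 0 ≤ p ω) → ∑ ω, p ω = 1 →
      ∀ (S : Type*) [MeasurableSpace S] (P : MeasureTheory.Measure S)
        [MeasureTheory.IsProbabilityMeasure P]
        (idx : Fin m → S → (Fin d → Fin N)) (Y : Fin m → S → ℤ),
        OneBit.IsOneBitSample P p f T idx Y →
      (2 ≤ d → ∀ Rmax : ℝ, OneBit.maxQNorm T ≤ Rmax →
        (∀ s, (OneBit.estimators f (OneBit.KMax d N α Rmax)
          (fun t => idx t s) (fun t => Y t s)).Nonempty) ∧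
        ∀ δ : ℝ, 0 < δ →
          1 - δ ≤ P.real {s | ∀ That ∈ OneBit.estimators f (OneBit.KMax d N α Rmax)
              (fun t => idx t s) (fun t => Y t s),
            OneBit.sqNormPi p (T - That) ≤
              Cmax * c₂ ^ d * OneBit.betaConst f α *
                (OneBit.Lconst f α * Rmax * Real.sqrt ((d : ℝ) * (N : ℝ) / (m : ℝ)) +
                  OneBit.Uconst f α * Real.sqrt (Real.log (4 / δ) / (m : ℝ)))}) ∧
      (∀ RM : ℝ, OneBit.mNorm T ≤ RM →
        (∀ s, (OneBit.estimators f (OneBit.KM d N α RM)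
          (fun t => idx t s) (fun t => Y t s)).Nonempty) ∧
        ∀ δ : ℝ, 0 < δ →
          1 - δ ≤ P.real {s | ∀ That ∈ OneBit.estimators f (OneBit.KM d N α RM)
              (fun t => idx t s) (fun t => Y t s),
            OneBit.sqNormPi p (T - That) ≤
              CM * OneBit.betaConst f α *
                (OneBit.Lconst f α * RM * Real.sqrt ((d : ℝ) * (N : ℝ) / (m : ℝ)) +
                  OneBit.Uconst f α * Real.sqrt (Real.log (4 / δ) / (m : ℝ)))}) := by
  obtain ⟨n, val, hval, hnet⟩ := OneBit.exists_quat_net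
  set κ := √(3 / 2) * (10 / 9) with hκ
  have hκ1 : 1 ≤ κ := by
    have : 1 ≤ √(3 / 2 : ℝ) := Real.one_le_sqrt.2 (by norm_num)
    linarith
  have hκ0 : 0 < κ := by linarith
  -- Numerically `κ² = 150/81 < 2`.
  have hκ2 : κ < √2 := by
    rw [hκ, Real.lt_sqrt (by positivity), mul_pow, Real.sq_sqrt (by norm_num)]
    norm_num
  have hn8 : (0 : ℝ) < 8 * (n + 1) := by positivity
  refine ⟨32 * (1 + 128 * (100 / 81) * √(8 * (n + 1))), 32 * (1 + √2), κ, by positivity,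
    by positivity, hκ0, hκ2, ?_⟩
  intro d N m hm hmN f α hf T hT p hp0 hp1 S _ P _ idx Y h
  have hp : OneBit.IsWeight p := ⟨hp0, hp1⟩
  have hm0 : 0 < m := by omega
  -- For `d = 0` or `N = 0` the condition `2 ≤ m ≤ N ^ d` fails.
  have hd : 0 < d := Nat.pos_of_ne_zero fun h0 => by
    rw [h0, pow_zero] at hmN; omega
  have hN : 0 < N := Nat.pos_of_ne_zero fun h0 => by
    rw [h0, zero_pow hd.ne'] at hmN; omega
  have hdN : 0 < d * N := Nat.mul_pos hd hN
  constructor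
  · intro hd2 R hR
    obtain ⟨d, rfl⟩ : ∃ e, d = e + 2 := ⟨d - 2, by omega⟩
    have hR0 : 0 ≤ R := (OneBit.maxQNorm_nonneg T).trans hR
    have hTK : T ∈ OneBit.KMax (d + 2) N α R := ⟨hT, hR⟩
    refine ⟨fun s => OneBit.estimators_nonempty hf (OneBit.isCompact_KMax α R)
      (fun X hX ω => abs_le.1 (hX.1 ω)) ⟨T, hTK⟩ _ _, fun δ hδ => ?_⟩
    have hne : Nonempty (Fin n) := (hnet 0 (by simp)).nonempty
    have hpow : 1 ≤ κ ^ (d + 2) := one_le_pow₀ hκ1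
    refine h.estimators_bound hf hp hm0 hd hN (fun j => OneBit.abs_quatFamily_le hval j) hn8
      (OneBit.card_quatFamily_le hdN) (c := 128 * (100 / 81) * κ ^ d) (by positivity) hR0
      (fun X hX => hX.1) (fun X hX A a hA => OneBit.sum_mul_le_of_maxQNorm_le hnet hX.2 A hA)
      hTK ?_ ?_ hδ
    · have : 0 ≤ √(8 * ((n : ℝ) + 1)) := Real.sqrt_nonneg _
      nlinarith
    -- The base case covers two orders, so the domination constant has exponent two less than the
    -- order; `κ ≥ 1` closes the gap.
    · have h1 : κ ^ d ≤ κ ^ (d + 2) := pow_le_pow_right₀ hκ1 (by omega)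
      have h2 : 0 ≤ 128 * (100 / 81) * √(8 * ((n : ℝ) + 1)) := by positivity
      nlinarith [mul_le_mul_of_nonneg_left h1 h2]
  · intro R hR
    obtain ⟨d, rfl⟩ : ∃ e, d = e + 1 := ⟨d - 1, by omega⟩
    have hR0 : 0 ≤ R := (OneBit.mNorm_nonneg T).trans hR
    have hTK : T ∈ OneBit.KM (d + 1) N α R := ⟨hT, hR⟩
    refine ⟨fun s => OneBit.estimators_nonempty hf (OneBit.isCompact_KM hN α R)
      (fun X hX ω => abs_le.1 (hX.1 ω)) ⟨T, hTK⟩ _ _, fun δ hδ => ?_⟩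
    refine h.estimators_bound hf hp hm0 hd hN OneBit.abs_signFamily_le two_pos
      (OneBit.card_signFamily_le hdN) (c := 1) zero_le_one hR0 (fun X hX => hX.1)
      (fun X hX A a hA => ?_) hTK ?_ ?_ hδ
    · rw [one_mul]
      exact OneBit.sum_mul_le_of_mNorm_le hN hX.2 A hA
    · have : 0 ≤ √(2 : ℝ) := Real.sqrt_nonneg _
      linarith
    · linarith
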